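/- Let $\mathbb K\in\{\mathbb R,\mathbb C\}$, let $H,E$ be Banach spaces over $\mathbb K$, and let $\mathcal X\subset\mathcal L(H,E)$ be a linear space of bounded operators which is a Banach space for a norm $\|\cdot\|_{\mathcal X}$ dominating the operator norm, i.e. $\|T\|_{\mathcal L(H,E)}\le K\|T\|_{\mathcal X}$ for all $T\in\mathcal X$ and some constant $K$ (equivalently, $\mathcal X$ is a Banach space with an injective bounded linear map into $\mathcal L(H,E)$). For a family $\mathcal T\subset\mathcal L(H,E)$ let $\mathcal R(\mathcal T)\in[0,\infty]$ be the smallest constant $C$ such that $$\mathbb E\Big\|\sum_{j=1}^N\varepsilon_jT_jx_j\Big\|^2\le C^2\,\mathbb E\Big\|\sum_{j=1}^N\varepsilon_jx_j\Big\|^2$$ for all $N$, all $T_1,\dots,T_N\in\mathcal T$ and all $x_1,\dots,x_N\in H$, where $\varepsilon_1,\dots,\varepsilon_N$ are independent random signs with $\mathbb P(\varepsilon_j=\pm1)=\tfrac12$ ($\mathcal R(\mathcal T)=\infty$ if there is no such constant). A filtration on a $\sigma$-finite measure space $(\Omega,\mathcal F,\mu)$ is an increasing family $(\mathcal F_j)_j$,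 indexed by $j\in\mathbb Z$ (or by $j\in\{0,1,2,\dots\}$), of sub-$\sigma$-algebras of $\mathcal F$ such that each $(\Omega,\mathcal F_j,\mu)$ is $\sigma$-finite. For $f\in L^p(\Omega;\mathcal X)$ let $E_jf=\mathbb E(f\mid\mathcal F_j)$ be the almost everywhere unique strongly $\mathcal F_j$-measurable function that is integrable over each $A\in\mathcal F_j$ of finite measure and satisfies $\int_AE_jf\,d\mu=\int_Af\,d\mu$ for these $A$, and let $M_Rf(\xi)=\mathcal R(\{E_jf(\xi):j\})$. For $1<p<\infty$, $\mathcal X$ has $\mathrm{RMF}_p$ with respect to $(\mathcal F_j)_j$ if there is a constant $C<\infty$ such that $\|M_Rf\|_{L^p}\le C\|f\|_{L^p(\mathcal X)}$ for all $f\in L^p(\Omega;\mathcal X)$. Theorem. Let $1<p<\infty$. If $\mathcal X$ has $\mathrm{RMF}_p$ with respect to the filtration $(\mathcal D_j)_{j\ge0}$ of dyadic intervals on $[0,1)$ with Lebesgue measure, where $\mathcal D_j$ is generated by the intervals $[(k-1)2^{-j},k2^{-j})$, $k=1,\dots,2^j$, then $\mathcal X$ has $\mathrm{RMF}_p$ with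 respect to every filtration $(\mathcal F_j)_{j\in\mathbb Z}$ on every $\sigma$-finite measure space. -/

import Mathlib

namespace RademacherMaximal

open MeasureTheory Set
open scoped ENNReal NNReal

section RBound

/-- `𝔼 ‖∑ j, ε j • x j‖ ^ 2` for independent symmetric signs `ε j`: the average over all
`2 ^ N` choices of signs. -/
noncomputable def rademacherSecondMoment {F : Type*} [NormedAddCommGroup F] {N : ℕ}
    (x : Fin N → F) : ℝ :=
  (∑ ε : Fin N → ℤˣ, ‖∑ j, ε j • x j‖ ^ 2) / 2 ^ N

variable {𝕜 H E : Type*} [RCLike 𝕜] [NormedAddCommGroup H] [NormedSpace 𝕜 H]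
  [NormedAddCommGroup E] [NormedSpace 𝕜 E]

/-- `C` is an admissible constant in the R-boundedness inequality (with exponent `2`) for the
family `𝒯`; operators may be repeated among the `T j`. -/
def IsRBoundConst (𝒯 : Set (H →L[𝕜] E)) (C : ℝ≥0) : Prop :=
  ∀ (N : ℕ) (T : Fin N → H →L[𝕜] E) (x : Fin N → H), (∀ j, T j ∈ 𝒯) →
    rademacherSecondMoment (fun j => T j (x j)) ≤ (C : ℝ) ^ 2 * rademacherSecondMoment x

/-- The R-bound `ℛ(𝒯) = ℛ₂(𝒯)` in `[0, ∞]`: the smallest admissible constant, and `∞` if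
the family is not R-bounded. -/
noncomputable def rBound (𝒯 : Set (H →L[𝕜] E)) : ℝ≥0∞ :=
  ⨅ (C : ℝ≥0) (_ : IsRBoundConst 𝒯 C), (C : ℝ≥0∞)

end RBound

section CondExp

variable {Ω X : Type*} [NormedAddCommGroup X] [NormedSpace ℝ X]

/-- `g` is a version of the conditional expectation `𝔼(f | m)`: it is strongly `m`-measurable,
integrable over the sets of `m` of finite measure, and has the same integrals as `f` over
these sets. Unlike for Mathlib's `condExp`, `f` need not be integrable over the whole space. -/
structure IsCondExp (m : MeasurableSpace Ω) {m₀ : MeasurableSpace Ω} (μ : Measure Ω)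
    (f g : Ω → X) : Prop where
  stronglyMeasurable : StronglyMeasurable[m] g
  integrableOn : ∀ A, MeasurableSet[m] A → μ A < ∞ → IntegrableOn g A μ
  setIntegral_eq : ∀ A, MeasurableSet[m] A → μ A < ∞ → ∫ ξ in A, g ξ ∂μ = ∫ ξ in A, f ξ ∂μ

open Classical in
/-- The conditional expectation `𝔼(f | m)`, an arbitrary version (and `0` if there is none; by
`exists_isCondExp` below this does not happen for the `f` of interest). -/
noncomputable def sigmaCondExp (m : MeasurableSpace Ω) {m₀ : MeasurableSpace Ω} (μ : Measure Ω)
    (f : Ω → X) : Ω → X :=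
  if h : ∃ g, IsCondExp m μ f g then h.choose else 0

/-- Conditional expectations are unique up to equality almost everywhere. -/
theorem IsCondExp.ae_eq [CompleteSpace X] {m m₀ : MeasurableSpace Ω} {μ : Measure Ω} (hm : m ≤ m₀)
    [SigmaFinite (μ.trim hm)] {f g g' : Ω → X} (hg : IsCondExp m μ f g)
    (hg' : IsCondExp m μ f g') : g =ᵐ[μ] g' :=
  ae_eq_of_forall_setIntegral_eq_of_sigmaFinite' hm hg.integrableOn hg'.integrableOn
    (fun s hs hμ => (hg.setIntegral_eq s hs hμ).trans (hg'.setIntegral_eq s hs hμ).symm)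
    hg.stronglyMeasurable.aestronglyMeasurable hg'.stronglyMeasurable.aestronglyMeasurable

/-- If `(Ω, m, μ)` is σ-finite and `f` is integrable over all sets of finite measure, then `f`
has a conditional expectation with respect to `m`. -/
theorem exists_isCondExp [CompleteSpace X] {m m₀ : MeasurableSpace Ω} {μ : Measure Ω}
    (hm : m ≤ m₀) [SigmaFinite (μ.trim hm)] {f : Ω → X}
    (hf : ∀ A, MeasurableSet[m₀] A → μ A < ∞ → IntegrableOn f A μ) :
    ∃ g, IsCondExp m μ f g := by
  classical
  set A : ℕ → Set Ω := disjointed (spanningSets (μ.trim hm)) with hA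
  have hAm : ∀ k, MeasurableSet[m] (A k) :=
    fun k => MeasurableSet.disjointed (fun i => measurableSet_spanningSets (μ.trim hm) i) k
  have hAd : Pairwise (Function.onFun Disjoint A) := disjoint_disjointed _
  have hAU : ⋃ k, A k = univ := by
    rw [hA, iUnion_disjointed, iUnion_spanningSets]
  have hAμ : ∀ k, μ (A k) < ∞ := by
    intro k
    rw [← trim_measurableSet_eq hm (hAm k)]
    exact (measure_mono (disjointed_subset _ k)).trans_lt (measure_spanningSets_lt_top _ k)
  have hfi : ∀ k, Integrable ((A k).indicator f) μ := fun k =>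
    (hf _ (hm _ (hAm k)) (hAμ k)).integrable_indicator (hm _ (hAm k))
  set G : ℕ → Ω → X := fun k => μ[(A k).indicator f | m] with hG
  have hGm : ∀ k, StronglyMeasurable[m] (G k) := fun k => stronglyMeasurable_condExp
  have hmem : ∀ ξ, ∃ k, ξ ∈ A k := fun ξ => mem_iUnion.1 (hAU ▸ mem_univ ξ)
  choose idx hidx using hmem
  have hidx_eq : ∀ k ξ, ξ ∈ A k → idx ξ = k := by
    intro k ξ h
    by_contra hne
    exact (Set.disjoint_left.1 (hAd hne)) (hidx ξ) h
  set g : Ω → X := fun ξ => G (idx ξ) ξ with hg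
  have hgA : ∀ k, EqOn g (G k) (A k) := fun k ξ h => by simp [hg, hidx_eq k ξ h]
  have hgm : StronglyMeasurable[m] g := by
    refine stronglyMeasurable_of_tendsto (f := fun n ξ =>
      ∑ k ∈ Finset.range n, (A k).indicator (G k) ξ) Filter.atTop
      (fun n => Finset.stronglyMeasurable_fun_sum _
        fun k _ => (hGm k).indicator (hAm k)) ?_
    rw [tendsto_pi_nhds]
    intro ξ
    refine tendsto_const_nhds.congr' ?_
    filter_upwards [Filter.eventually_gt_atTop (idx ξ)] with n hn
    rw [Finset.sum_eq_single_of_mem (idx ξ) (Finset.mem_range.2 hn)]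
    · simp [hg, hidx ξ]
    · intro k _ hk
      exact indicator_of_notMem (fun h => hk (hidx_eq k ξ h).symm) _
  have hsplit : ∀ s : Set Ω, s = ⋃ k, s ∩ A k := fun s => by
    rw [← inter_iUnion, hAU, inter_univ]
  have hsd : ∀ s : Set Ω, Pairwise (Function.onFun Disjoint fun k => s ∩ A k) := fun s i j hij =>
    (hAd hij).mono inter_subset_right inter_subset_right
  have hpiece : ∀ s, MeasurableSet[m] s → ∀ k,
      ∫⁻ ξ in s ∩ A k, ‖g ξ‖ₑ ∂μ ≤ ∫⁻ ξ in s ∩ A k, ‖f ξ‖ₑ ∂μ := by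
    intro s hs k
    have hsk := hs.inter (hAm k)
    have h1 : ∫⁻ ξ in s ∩ A k, ‖g ξ‖ₑ ∂μ = eLpNorm ((s ∩ A k).indicator (G k)) 1 μ := by
      rw [eLpNorm_one_eq_lintegral_enorm, ← lintegral_indicator (hm _ hsk)]
      refine lintegral_congr fun ξ => ?_
      by_cases h : ξ ∈ s ∩ A k
      · simp [h, hgA k h.2]
      · simp [h]
    have h2 : (s ∩ A k).indicator (G k) =ᵐ[μ] μ[(s ∩ A k).indicator f | m] := by
      have := (condExp_indicator (m := m) (hfi k) hsk).symm
      rwa [indicator_indicator, inter_assoc, inter_self] at this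
    rw [h1, eLpNorm_congr_ae h2]
    refine (eLpNorm_condExp_le_eLpNorm _ le_rfl).trans_eq ?_
    rw [eLpNorm_one_eq_lintegral_enorm, ← lintegral_indicator (hm _ hsk)]
    refine lintegral_congr fun ξ => ?_
    by_cases h : ξ ∈ s ∩ A k <;> simp [h]
  have hgi : ∀ s, MeasurableSet[m] s → μ s < ∞ → IntegrableOn g s μ := by
    intro s hs hμ
    refine ⟨(hgm.mono hm).aestronglyMeasurable, ?_⟩
    have hfs := (hf s (hm _ hs) hμ).2
    rw [hasFiniteIntegral_iff_enorm] at hfs ⊢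
    refine lt_of_le_of_lt ?_ hfs
    rw [hsplit s, lintegral_iUnion (fun k => hm _ (hs.inter (hAm k))) (hsd s),
      lintegral_iUnion (fun k => hm _ (hs.inter (hAm k))) (hsd s)]
    exact ENNReal.tsum_le_tsum fun k => hpiece s hs k
  refine ⟨g, hgm, hgi, fun s hs hμ => ?_⟩
  have hI1 := hgi s hs hμ
  have hI2 := hf s (hm _ hs) hμ
  rw [hsplit s] at hI1 hI2 ⊢
  rw [integral_iUnion (fun k => hm _ (hs.inter (hAm k))) (hsd s) hI1,
    integral_iUnion (fun k => hm _ (hs.inter (hAm k))) (hsd s) hI2]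
  refine tsum_congr fun k => ?_
  have hsk := hs.inter (hAm k)
  rw [setIntegral_congr_fun (hm _ hsk) (fun ξ h => hgA k h.2),
    setIntegral_condExp hm (hfi k) hsk]
  exact setIntegral_congr_fun (hm _ hsk) (fun ξ h => indicator_of_mem h.2 f)

/-- In particular every `f` in `L^p`, `1 ≤ p`, has a conditional expectation. -/
theorem isCondExp_sigmaCondExp [CompleteSpace X] {m m₀ : MeasurableSpace Ω} {μ : Measure Ω}
    (hm : m ≤ m₀) [SigmaFinite (μ.trim hm)] {p : ℝ≥0∞} (hp : 1 ≤ p) {f : Ω → X}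
    (hf : MemLp f p μ) : IsCondExp m μ f (sigmaCondExp m μ f) := by
  have h : ∃ g, IsCondExp m μ f g := exists_isCondExp hm fun A _ hA => by
    have : IsFiniteMeasure (μ.restrict A) := isFiniteMeasure_restrict.2 hA.ne
    exact (hf.restrict A).integrable hp
  rw [sigmaCondExp, dif_pos h]
  exact h.choose_spec

end CondExp

section RMF

variable {𝕜 H E X : Type*} [RCLike 𝕜] [NormedAddCommGroup H] [NormedSpace 𝕜 H]
  [NormedAddCommGroup E] [NormedSpace 𝕜 E]
  [NormedAddCommGroup X] [NormedSpace 𝕜 X] [NormedSpace ℝ X]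
  {Ω ι : Type*} [Preorder ι] {mΩ : MeasurableSpace Ω}

/-- The Rademacher maximal function `M_R f(ξ) = ℛ(E_j f(ξ) : j)`, where the values of `f` are
regarded as operators through the map `J`. -/
noncomputable def rademacherMaximalFunction (J : X →L[𝕜] H →L[𝕜] E) (ℱ : Filtration ι mΩ)
    (μ : Measure Ω) (f : Ω → X) (ξ : Ω) : ℝ≥0∞ :=
  rBound (range fun j => J (sigmaCondExp (ℱ j) μ f ξ))

/-- `X`, viewed as a space of operators through `J`, has `RMF_p` with respect to the filtration
`ℱ`: the Rademacher maximal operator is bounded from `L^p(X)` to `L^p`. -/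
def HasRMF (J : X →L[𝕜] H →L[𝕜] E) (p : ℝ≥0∞) (ℱ : Filtration ι mΩ) (μ : Measure Ω) : Prop :=
  ∃ C : ℝ≥0, ∀ f : Ω → X, MemLp f p μ →
    eLpNorm (rademacherMaximalFunction J ℱ μ f) p μ ≤ C * eLpNorm f p μ

end RMF

section Dyadic

/-- Lebesgue measure on `[0, 1)`. -/
noncomputable def unitIntervalMeasure : Measure (Ico (0 : ℝ) 1) :=
  Measure.comap Subtype.val volume

/-- The dyadic interval `[k 2⁻ʲ, (k + 1) 2⁻ʲ)` as a subset of `[0, 1)`. -/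
def dyadicInterval (j k : ℕ) : Set (Ico (0 : ℝ) 1) :=
  {x | (k : ℝ) / 2 ^ j ≤ x ∧ (x : ℝ) < (k + 1) / 2 ^ j}

/-- The algebra of dyadic intervals of length `2⁻ʲ` on `[0, 1)`. -/
@[reducible] def dyadicAlgebra (j : ℕ) : MeasurableSpace (Ico (0 : ℝ) 1) :=
  MeasurableSpace.generateFrom {A | ∃ k < 2 ^ j, A = dyadicInterval j k}

theorem dyadicInterval_split (j k : ℕ) :
    dyadicInterval j k = dyadicInterval (j + 1) (2 * k) ∪ dyadicInterval (j + 1) (2 * k + 1) := by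
  have h : (0 : ℝ) < 2 ^ j := by positivity
  ext x
  simp only [dyadicInterval, mem_ofPred_eq, mem_union, div_le_iff₀ h, lt_div_iff₀ h, pow_succ,
    div_le_iff₀ (mul_pos h two_pos), lt_div_iff₀ (mul_pos h two_pos)]
  push_cast
  constructor
  · rintro ⟨h1, h2⟩
    rcases lt_or_ge ((x : ℝ) * (2 ^ j * 2)) (2 * k + 1) with h3 | h3
    · left; constructor <;> linarith
    · right; constructor <;> linarith
  · rintro (⟨h1, h2⟩ | ⟨h1, h2⟩) <;> constructor <;> linarith

/-- The filtration of dyadic intervals on `[0, 1)`. -/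
def dyadicFiltration :
    Filtration ℕ (Subtype.instMeasurableSpace : MeasurableSpace (Ico (0 : ℝ) 1)) where
  seq := dyadicAlgebra
  mono' := by
    refine monotone_nat_of_le_succ fun j => MeasurableSpace.generateFrom_le ?_
    rintro _ ⟨k, hk, rfl⟩
    rw [dyadicInterval_split]
    refine MeasurableSet.union (MeasurableSpace.measurableSet_generateFrom ⟨2 * k, ?_, rfl⟩)
      (MeasurableSpace.measurableSet_generateFrom ⟨2 * k + 1, ?_, rfl⟩) <;>
      rw [pow_succ] <;> omega
  le' := by
    intro j
    refine MeasurableSpace.generateFrom_le ?_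
    rintro _ ⟨k, -, rfl⟩
    exact (measurableSet_le measurable_const measurable_subtype_coe).inter
      (measurableSet_lt measurable_subtype_coe measurable_const)

end Dyadic

end RademacherMaximal

/-! An inequality for dyadic martingales yields a function that is concave in the current value of
the martingale, and by Jensen such a function proves the same inequality for every martingale. Fix a
truncation level M and let φ(S) = min(ℛ(S), M)^p and ψ(x) = C^p ‖x‖^p, where C is the dyadic
constant. For a set S of past values let u(S, x) be the supremum of the mean of φ(S ∪ path) - ψ(end)
over finite dyadic martingales started at x (`bellman`).

The dyadic hypothesis gives u(∅, ·) ≤ 0 (`gain_nonpos_of_dyadic`). A fair coin toss from (x + y)/2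
to x or y shows that u(S, ·) is midpoint concave (`bellman_midpoint`); the continuous lower bound -ψ
upgrades this to concavity and continuity. Since u(S ∪ {x}, x) = u(S, x), the mean of u(past,
present) decreases along each martingale generated by simple functions
(`integral_bellman_condExp_le`), so the mean of φ is at most that of ψ.

The rest is limits. A finite martingale on a finite measure space is approximated in L^p by simple
ones (`exists_simple_approx`), and Fatou applies because the R-bound is lower semicontinuous. A
σ-finite space is cut along the coarsest σ-algebra (`lintegral_isCondExp_le`). Finally M and the
number of times increase together, by monotone convergence. The constant C never changes. -/

namespace RademacherMaximal

open MeasureTheory Set Filter Topology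
open scoped ENNReal NNReal

/-! ### R-bounds: attainment, monotonicity, semicontinuity -/

section RBound

variable {𝕜 H E X : Type*} [RCLike 𝕜] [NormedAddCommGroup H] [NormedSpace 𝕜 H]
  [NormedAddCommGroup E] [NormedSpace 𝕜 E]

theorem IsRBoundConst.mono {𝒯 : Set (H →L[𝕜] E)} {C D : ℝ≥0} (h : IsRBoundConst 𝒯 C)
    (hCD : C ≤ D) : IsRBoundConst 𝒯 D := by
  intro N T x hT
  refine (h N T x hT).trans ?_
  have h0 : 0 ≤ rademacherSecondMoment x := by unfold rademacherSecondMoment; positivity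
  gcongr

/-- The infimum is attained: for fixed operators and vectors the inequality is closed in the
constant, so it survives letting D decrease to C. -/
theorem rBound_le_iff {𝒯 : Set (H →L[𝕜] E)} {C : ℝ≥0} :
    rBound 𝒯 ≤ C ↔ IsRBoundConst 𝒯 C := by
  refine ⟨fun h => ?_, fun h => iInf₂_le C h⟩
  intro N T x hT
  have hlim : Tendsto (fun D : ℝ≥0 => (D : ℝ) ^ 2 * rademacherSecondMoment x) (𝓝[>] C)
      (𝓝 ((C : ℝ) ^ 2 * rademacherSecondMoment x)) := by
    refine Tendsto.mono_left ?_ nhdsWithin_le_nhds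
    exact Continuous.tendsto (by fun_prop) C
  refine ge_of_tendsto hlim ?_
  filter_upwards [self_mem_nhdsWithin] with D hD
  have hlt : rBound 𝒯 < D := h.trans_lt (by exact_mod_cast hD)
  simp only [rBound, iInf_lt_iff] at hlt
  obtain ⟨C', hC', hlt⟩ := hlt
  exact hC'.mono (by exact_mod_cast hlt.le) N T x hT

theorem rBound_mono : Monotone (rBound : Set (H →L[𝕜] E) → ℝ≥0∞) := by
  intro 𝒮 𝒯 h
  exact le_iInf₂ fun C hC => iInf₂_le C fun N T x hT => hC N T x fun j => h (hT j)

/-- The R-bound of a family is detected on a finite subfamily. -/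
theorem exists_lt_of_lt_rBound {𝒯 : Set (H →L[𝕜] E)} {c : ℝ≥0} (h : (c : ℝ≥0∞) < rBound 𝒯) :
    ∃ (N : ℕ) (T : Fin N → H →L[𝕜] E) (x : Fin N → H), (∀ j, T j ∈ 𝒯) ∧
      (c : ℝ) ^ 2 * rademacherSecondMoment x < rademacherSecondMoment (fun j => T j (x j)) := by
  have h' : ¬ IsRBoundConst 𝒯 c := fun hc => (rBound_le_iff.2 hc).not_gt h
  simpa [IsRBoundConst] using h'

theorem lt_rBound {𝒯 : Set (H →L[𝕜] E)} {c : ℝ≥0} {N : ℕ} {T : Fin N → H →L[𝕜] E}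
    {x : Fin N → H} (hT : ∀ j, T j ∈ 𝒯)
    (h : (c : ℝ) ^ 2 * rademacherSecondMoment x < rademacherSecondMoment (fun j => T j (x j))) :
    (c : ℝ≥0∞) < rBound 𝒯 := by
  by_contra hc
  exact (rBound_le_iff.1 (not_lt.1 hc) N T x hT).not_gt h

/-- The R-bound is continuous along increasing unions. -/
theorem rBound_iUnion_of_monotone {S : ℕ → Set (H →L[𝕜] E)} (hS : Monotone S) :
    rBound (⋃ n, S n) = ⨆ n, rBound (S n) := by
  refine le_antisymm ?_ (iSup_le fun n => rBound_mono (subset_iUnion S n))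
  refine ENNReal.le_of_forall_nnreal_lt fun c hc => ?_
  obtain ⟨c', hc'₁, hc'₂⟩ := ENNReal.lt_iff_exists_nnreal_btwn.1 hc
  clear hc
  obtain ⟨N, T, x, hT, h⟩ := exists_lt_of_lt_rBound hc'₂
  choose k hk using fun j => mem_iUnion.1 (hT j)
  have hmem : ∀ j, T j ∈ S (Finset.univ.sup k) := fun j =>
    hS (Finset.le_sup (Finset.mem_univ j)) (hk j)
  exact hc'₁.le.trans ((lt_rBound hmem h).le.trans (le_iSup (fun n => rBound (S n)) _))

/-- The R-bound of finitely many operators is a lower semicontinuous function of them. -/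
theorem lowerSemicontinuous_rBound_range {ι : Type*} [TopologicalSpace X]
    {J : X → H →L[𝕜] E} (hJ : Continuous J) :
    LowerSemicontinuous fun a : ι → X => rBound (range fun i => J (a i)) := by
  intro a c hc
  obtain ⟨c', hcc', hc'⟩ := ENNReal.lt_iff_exists_nnreal_btwn.1 hc
  obtain ⟨N, T, x, hT, h⟩ := exists_lt_of_lt_rBound hc'
  choose i hi using hT
  have hcont : Continuous fun b : ι → X =>
      rademacherSecondMoment (fun j => J (b (i j)) (x j)) := by
    unfold rademacherSecondMoment
    fun_prop
  have hev : ∀ᶠ b in 𝓝 a, (c' : ℝ) ^ 2 * rademacherSecondMoment x <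
      rademacherSecondMoment (fun j => J (b (i j)) (x j)) := by
    refine hcont.continuousAt.eventually_const_lt ?_
    simpa [hi] using h
  filter_upwards [hev] with b hb
  exact hcc'.trans (lt_rBound (T := fun j => J (b (i j))) (fun j => mem_range_self _) hb)

end RBound

/-! ### Midpoint concavity and continuity -/

section Concave

/-- A midpoint concave function on `[0, 1]` that vanishes at the endpoints and is bounded below is
nonnegative. -/
theorem nonneg_of_midpoint_concave {φ : ℝ → ℝ} (h0 : φ 0 = 0) (h1 : φ 1 = 0)
    (hmid : ∀ s ∈ Icc (0 : ℝ) 1, ∀ t ∈ Icc (0 : ℝ) 1, (φ s + φ t) / 2 ≤ φ ((s + t) / 2))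
    {m : ℝ} (hm : ∀ t ∈ Icc (0 : ℝ) 1, m ≤ φ t) {t : ℝ} (ht : t ∈ Icc (0 : ℝ) 1) : 0 ≤ φ t := by
  have hbdd : BddBelow (φ '' Icc 0 1) := ⟨m, by rintro _ ⟨t, ht, rfl⟩; exact hm t ht⟩
  have hle : ∀ t ∈ Icc (0 : ℝ) 1, sInf (φ '' Icc 0 1) ≤ φ t :=
    fun t ht => csInf_le hbdd (mem_image_of_mem φ ht)
  -- Every t is the midpoint of an endpoint, where φ vanishes, and another point of [0, 1]. Hence
  -- the infimum is at least half of itself, which forces it to be nonnegative.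
  have hhalf : sInf (φ '' Icc 0 1) / 2 ≤ sInf (φ '' Icc 0 1) := by
    refine le_csInf ⟨_, mem_image_of_mem φ ht⟩ ?_
    rintro _ ⟨t, ht, rfl⟩
    rcases le_total t (1 / 2) with h | h
    · have hs : 2 * t ∈ Icc (0 : ℝ) 1 := ⟨by linarith [ht.1], by linarith⟩
      have := hmid 0 (by simp) (2 * t) hs
      rw [h0, show (0 + 2 * t) / 2 = t by ring] at this
      linarith [hle _ hs]
    · have hs : 2 * t - 1 ∈ Icc (0 : ℝ) 1 := ⟨by linarith, by linarith [ht.2]⟩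
      have := hmid 1 (by simp) (2 * t - 1) hs
      rw [h1, show (1 + (2 * t - 1)) / 2 = t by ring] at this
      linarith [hle _ hs]
  linarith [hle t ht]

/-- A midpoint concave function that is bounded below by a continuous function is concave. -/
theorem concaveOn_univ_of_midpoint {X : Type*} [NormedAddCommGroup X] [NormedSpace ℝ X]
    {u ψ : X → ℝ} (hψ : Continuous ψ) (hψu : ∀ x, ψ x ≤ u x)
    (hmid : ∀ x y, (u x + u y) / 2 ≤ u ((1 / 2 : ℝ) • (x + y))) : ConcaveOn ℝ univ u := by
  refine ⟨convex_univ, fun x _ y _ a b ha hb hab => ?_⟩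
  set l : ℝ → X := fun t => (1 - t) • x + t • y with hl
  have hlc : Continuous l := by fun_prop
  -- Subtracting the chord makes the restriction of u to the segment vanish at both ends and
  -- preserves midpoint concavity.
  set φ : ℝ → ℝ := fun t => u (l t) - ((1 - t) * u x + t * u y) with hφ
  have hb1 : b ∈ Icc (0 : ℝ) 1 := ⟨hb, by linarith⟩
  have hcont : ContinuousOn (fun t => ψ (l t) - ((1 - t) * u x + t * u y)) (Icc 0 1) := by
    fun_prop
  obtain ⟨m, hm⟩ := isCompact_Icc.bddBelow_image hcont
  have key : 0 ≤ φ b := by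
    refine nonneg_of_midpoint_concave (m := m) (by simp [hφ, hl]) (by simp [hφ, hl]) ?_ ?_ hb1
    · intro s _ t _
      have h := hmid (l s) (l t)
      have : (1 / 2 : ℝ) • (l s + l t) = l ((s + t) / 2) := by
        simp only [hl]; module
      rw [this] at h
      simp only [hφ]
      linarith
    · intro t ht
      exact (hm (mem_image_of_mem _ ht)).trans (sub_le_sub_right (hψu _) _)
  obtain rfl : a = 1 - b := by linarith
  simp only [hφ, hl] at key
  simp only [smul_eq_mul]
  linarith

/-- A concave function on the whole space is continuous once it is bounded below near a single
point; near 0 the bound is ψ 0 - 1. -/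
theorem ConcaveOn.continuous_of_continuous_le {X : Type*} [NormedAddCommGroup X]
    [NormedSpace ℝ X] {u ψ : X → ℝ} (hu : ConcaveOn ℝ univ u) (hψ : Continuous ψ)
    (hψu : ∀ x, ψ x ≤ u x) : Continuous u := by
  rw [← continuousOn_univ]
  have hbdd : ∃ x₀ ∈ (univ : Set X), (𝓝 x₀).IsBoundedUnder (· ≥ ·) u := by
    refine ⟨0, mem_univ _, ψ 0 - 1, ?_⟩
    rw [eventually_map]
    filter_upwards [hψ.continuousAt.eventually_const_lt (sub_one_lt (ψ 0))] with x hx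
    exact hx.le.trans (hψu x)
  exact ((hu.continuousOn_tfae isOpen_univ univ_nonempty).out 3 1).1 hbdd

end Concave

/-! ### Dyadic martingales as trees, and the Bellman function -/

section Tree

variable {X : Type*}

/-- Finite binary trees with values at the leaves, as a model for dyadic step functions. -/
inductive BinTree (X : Type*) where
  | leaf (x : X) : BinTree X
  | node (l r : BinTree X) : BinTree X

variable [NormedAddCommGroup X] [NormedSpace ℝ X]

namespace BinTree

/-- The mean of the dyadic step function given by a tree. -/
noncomputable def mean : BinTree X → X
  | leaf x => x
  | node l r => (1 / 2 : ℝ) • (mean l + mean r)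

/-- The mean of `φ (S ∪ {values of the martingale}) - ψ (terminal value)` for the dyadic martingale
given by a tree. -/
noncomputable def gain (φ : Set X → ℝ) (ψ : X → ℝ) : Set X → BinTree X → ℝ
  | S, leaf x => φ (insert x S) - ψ x
  | S, node l r => (gain φ ψ (insert (mean (node l r)) S) l +
      gain φ ψ (insert (mean (node l r)) S) r) / 2

variable {φ : Set X → ℝ} {ψ : X → ℝ}

/-- The bound makes the supremum in `bellman` a genuine real supremum; this is why the R-bound has
to be truncated. -/
theorem gain_le {B : ℝ} (hφ : ∀ S, φ S ≤ B) (hψ : ∀ x, 0 ≤ ψ x) (S : Set X) (t : BinTree X) :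
    gain φ ψ S t ≤ B := by
  induction t generalizing S with
  | leaf x => simp only [gain]; linarith [hφ (insert x S), hψ x]
  | node l r hl hr =>
    simp only [gain]
    linarith [hl (insert (mean (node l r)) S), hr (insert (mean (node l r)) S)]

theorem gain_mono (hφ : Monotone φ) {S S' : Set X} (h : S ⊆ S') (t : BinTree X) :
    gain φ ψ S t ≤ gain φ ψ S' t := by
  induction t generalizing S S' with
  | leaf x => simpa [gain] using hφ (insert_subset_insert h)
  | node l r hl hr =>
    simp only [gain]
    have h' := insert_subset_insert (a := mean (node l r)) h
    linarith [hl h', hr h']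

theorem gain_insert_mean (S : Set X) (t : BinTree X) :
    gain φ ψ (insert (mean t) S) t = gain φ ψ S t := by
  cases t <;> simp [gain, mean]

end BinTree

open BinTree

/-- The Bellman function: the largest gain of a dyadic martingale with a given starting point. -/
noncomputable def bellman (φ : Set X → ℝ) (ψ : X → ℝ) (S : Set X) (x : X) : ℝ :=
  sSup (gain φ ψ S '' {t | mean t = x})

variable {φ : Set X → ℝ} {ψ : X → ℝ} {B : ℝ}

theorem bddAbove_gain (hφ : ∀ S, φ S ≤ B) (hψ : ∀ x, 0 ≤ ψ x) (S : Set X) (x : X) :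
    BddAbove (gain φ ψ S '' {t | mean t = x}) :=
  ⟨B, by rintro _ ⟨t, -, rfl⟩; exact gain_le hφ hψ S t⟩

theorem gain_le_bellman (hφ : ∀ S, φ S ≤ B) (hψ : ∀ x, 0 ≤ ψ x) (S : Set X) (t : BinTree X) :
    gain φ ψ S t ≤ bellman φ ψ S (mean t) :=
  le_csSup (bddAbove_gain hφ hψ S _) ⟨t, rfl, rfl⟩

theorem bellman_le {S : Set X} {x : X} {c : ℝ} (h : ∀ t, mean t = x → gain φ ψ S t ≤ c) :
    bellman φ ψ S x ≤ c :=
  csSup_le ⟨_, leaf x, rfl, rfl⟩ (by rintro _ ⟨t, ht, rfl⟩; exact h t ht)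

theorem sub_le_bellman (hφ : ∀ S, φ S ≤ B) (hψ : ∀ x, 0 ≤ ψ x) (S : Set X) (x : X) :
    φ (insert x S) - ψ x ≤ bellman φ ψ S x := by
  simpa [gain, mean] using gain_le_bellman hφ hψ S (leaf x)

/-- The martingale records its starting point anyway. This lets the current value join the past at
no cost. -/
theorem bellman_insert (S : Set X) (x : X) :
    bellman φ ψ (insert x S) x = bellman φ ψ S x := by
  unfold bellman
  congr 1
  refine image_congr ?_
  rintro t rfl
  exact gain_insert_mean S t

/-- Trees with means x and y, joined under a new root, compete for the supremum at the midpoint. The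
root adds one more value to the past, which can only raise the gain because φ is monotone. -/
theorem bellman_midpoint (hφm : Monotone φ) (hφ : ∀ S, φ S ≤ B) (hψ : ∀ x, 0 ≤ ψ x) (S : Set X)
    (x y : X) :
    (bellman φ ψ S x + bellman φ ψ S y) / 2 ≤ bellman φ ψ S ((1 / 2 : ℝ) • (x + y)) := by
  set c := bellman φ ψ S ((1 / 2 : ℝ) • (x + y))
  have h : ∀ s t, mean s = x → mean t = y → gain φ ψ S s + gain φ ψ S t ≤ 2 * c := by
    rintro s t rfl rfl
    have h1 := gain_le_bellman hφ hψ S (node s t)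
    simp only [gain] at h1
    have hsub := subset_insert (mean (node s t)) S
    have h2 := gain_mono (ψ := ψ) hφm hsub s
    have h3 := gain_mono (ψ := ψ) hφm hsub t
    change _ ≤ c at h1
    linarith
  have h1 : ∀ s, mean s = x → gain φ ψ S s + bellman φ ψ S y ≤ 2 * c := by
    intro s hs
    have : bellman φ ψ S y ≤ 2 * c - gain φ ψ S s :=
      bellman_le fun t ht => by linarith [h s t hs ht]
    linarith
  have h2 : bellman φ ψ S x ≤ 2 * c - bellman φ ψ S y :=
    bellman_le fun s hs => by linarith [h1 s hs]
  linarith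

theorem neg_le_bellman (hφ0 : ∀ S, 0 ≤ φ S) (hφ : ∀ S, φ S ≤ B) (hψ : ∀ x, 0 ≤ ψ x) (S : Set X)
    (x : X) : -ψ x ≤ bellman φ ψ S x :=
  le_trans (by linarith [hφ0 (insert x S)]) (sub_le_bellman hφ hψ S x)

theorem concaveOn_bellman (hφm : Monotone φ) (hφ0 : ∀ S, 0 ≤ φ S) (hφ : ∀ S, φ S ≤ B)
    (hψ : ∀ x, 0 ≤ ψ x) (hψc : Continuous ψ) (S : Set X) :
    ConcaveOn ℝ univ (bellman φ ψ S) :=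
  concaveOn_univ_of_midpoint hψc.neg (neg_le_bellman hφ0 hφ hψ S) (bellman_midpoint hφm hφ hψ S)

theorem continuous_bellman (hφm : Monotone φ) (hφ0 : ∀ S, 0 ≤ φ S) (hφ : ∀ S, φ S ≤ B)
    (hψ : ∀ x, 0 ≤ ψ x) (hψc : Continuous ψ) (S : Set X) : Continuous (bellman φ ψ S) :=
  ConcaveOn.continuous_of_continuous_le (concaveOn_bellman hφm hφ0 hφ hψ hψc S) hψc.neg
    (neg_le_bellman hφ0 hφ hψ S)

end Tree

/-! ### Martingales generated by simple functions -/

section SimpleMartingale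

variable {Ω γ X : Type*} {mΩ : MeasurableSpace Ω} {ν : Measure Ω}

/-- Such an F is itself a simple function, so the Bellman function needs no measurability in its set
argument. -/
theorem SimpleFunc.integrable_of_factorsThrough [IsFiniteMeasure ν] {F : Ω → ℝ} {T : SimpleFunc Ω γ}
    (hF : F.FactorsThrough T) : Integrable F ν := by
  have h : F = T.map (Function.extend T F 0) := by
    ext ξ
    simp [hF.extend_apply]
  rw [h]
  exact SimpleFunc.integrable_of_isFiniteMeasure _

/-- Integrals may be compared on the fibers of a simple function. -/
theorem SimpleFunc.integral_mono_of_fiber {F G : Ω → ℝ} (T : SimpleFunc Ω γ)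
    (hF : Integrable F ν) (hG : Integrable G ν)
    (h : ∀ ξ, ∫ η in T ⁻¹' {T ξ}, F η ∂ν ≤ ∫ η in T ⁻¹' {T ξ}, G η ∂ν) :
    ∫ ξ, F ξ ∂ν ≤ ∫ ξ, G ξ ∂ν := by
  have hU : (univ : Set Ω) = ⋃ y ∈ T.range, T ⁻¹' {y} := by
    ext ξ; simp
  have hd : Pairwise (Function.onFun Disjoint fun y => T ⁻¹' {y}) :=
    fun y z hyz => Disjoint.preimage _ (by simpa using hyz)
  rw [← setIntegral_univ, ← setIntegral_univ (f := G), hU,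
    integral_biUnion_finset _ (fun y _ => T.measurableSet_fiber y) (hd.set_pairwise _)
      (fun y _ => hF.integrableOn),
    integral_biUnion_finset _ (fun y _ => T.measurableSet_fiber y) (hd.set_pairwise _)
      (fun y _ => hG.integrableOn)]
  refine Finset.sum_le_sum fun y hy => ?_
  obtain ⟨ξ, rfl⟩ := SimpleFunc.mem_range.1 hy
  exact h ξ

variable [NormedAddCommGroup X] [NormedSpace ℝ X]

/-- The σ-algebra generated by a simple function. -/
@[reducible] def SimpleFunc.sigmaAlgebra (T : SimpleFunc Ω γ) : MeasurableSpace Ω :=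
  MeasurableSpace.comap T ⊤

theorem SimpleFunc.sigmaAlgebra_le (T : SimpleFunc Ω γ) : SimpleFunc.sigmaAlgebra T ≤ mΩ := by
  rintro _ ⟨s, -, rfl⟩
  exact T.measurableSet_preimage s

/-- The factorization holds at every point, not just almost everywhere, because the chosen version
is strongly measurable for the σ-algebra of T. -/
theorem SimpleFunc.condExp_factorsThrough (T : SimpleFunc Ω γ) (f : Ω → X) :
    (ν[f | SimpleFunc.sigmaAlgebra T]).FactorsThrough T := by
  let _ : MeasurableSpace γ := ⊤
  exact StronglyMeasurable.factorsThrough stronglyMeasurable_condExp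

variable [IsFiniteMeasure ν] [CompleteSpace X] {φ : Set X → ℝ} {ψ : X → ℝ} {B : ℝ} {f : Ω → X}

/-- For a martingale generated by simple functions, the integral of the Bellman function decreases
along the martingale. -/
theorem integral_bellman_condExp_le (hφm : Monotone φ) (hφ0 : ∀ S, 0 ≤ φ S) (hφ : ∀ S, φ S ≤ B)
    (hψ : ∀ x, 0 ≤ ψ x) (hψc : Continuous ψ) (hf : Integrable f ν) (T T' : SimpleFunc Ω γ)
    (hT : (T : Ω → γ).FactorsThrough T') {P : Ω → Set X} (hP : P.FactorsThrough T) :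
    ∫ ξ, bellman φ ψ (P ξ) ((ν[f | SimpleFunc.sigmaAlgebra T']) ξ) ∂ν ≤
      ∫ ξ, bellman φ ψ (P ξ) ((ν[f | SimpleFunc.sigmaAlgebra T]) ξ) ∂ν := by
  have h' := SimpleFunc.condExp_factorsThrough (ν := ν) T' f
  have h := SimpleFunc.condExp_factorsThrough (ν := ν) T f
  have hi' : Integrable
      (fun ξ => bellman φ ψ (P ξ) ((ν[f | SimpleFunc.sigmaAlgebra T']) ξ)) ν :=
    SimpleFunc.integrable_of_factorsThrough (T := T') fun a b hab => by
      simp only [hP (hT hab), h' hab]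
  have hi : Integrable (fun ξ => bellman φ ψ (P ξ) ((ν[f | SimpleFunc.sigmaAlgebra T]) ξ)) ν :=
    SimpleFunc.integrable_of_factorsThrough (T := T) fun a b hab => by
      simp only [hP hab, h hab]
  refine SimpleFunc.integral_mono_of_fiber T hi' hi fun ξ => ?_
  set A := T ⁻¹' {T ξ} with hA
  have hAm : MeasurableSet A := T.measurableSet_fiber _
  have hAT : MeasurableSet[SimpleFunc.sigmaAlgebra T] A := ⟨{T ξ}, trivial, rfl⟩
  have hle : SimpleFunc.sigmaAlgebra T ≤ SimpleFunc.sigmaAlgebra T' := by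
    rintro _ ⟨s, -, rfl⟩
    refine ⟨T' '' (T ⁻¹' s), trivial, ?_⟩
    ext η
    constructor
    · rintro ⟨ζ, hζ, hζη⟩
      have := hT hζη
      simpa [← this] using hζ
    · exact fun hη => ⟨η, hη, rfl⟩
  have hc : ∀ η ∈ A, P η = P ξ ∧
      (ν[f | SimpleFunc.sigmaAlgebra T]) η = (ν[f | SimpleFunc.sigmaAlgebra T]) ξ :=
    fun η hη => ⟨hP hη, h hη⟩
  by_cases h0 : ν A = 0
  · simp [Measure.restrict_eq_zero.2 h0]
  -- The martingale property on a fiber of T: the earlier, constant value is the average of the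
  -- later one.
  have havg : ⨍ η in A, (ν[f | SimpleFunc.sigmaAlgebra T']) η ∂ν =
      (ν[f | SimpleFunc.sigmaAlgebra T]) ξ := by
    have h1 : ∫ η in A, (ν[f | SimpleFunc.sigmaAlgebra T']) η ∂ν =
        ∫ η in A, (ν[f | SimpleFunc.sigmaAlgebra T]) η ∂ν := by
      rw [setIntegral_condExp (SimpleFunc.sigmaAlgebra_le T') hf (hle _ hAT),
        setIntegral_condExp (SimpleFunc.sigmaAlgebra_le T) hf hAT]
    rw [setAverage_eq, h1, setIntegral_congr_fun hAm fun η hη => (hc η hη).2, setIntegral_const,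
      smul_smul, inv_mul_cancel₀, one_smul]
    simp [Measure.real, ENNReal.toReal_eq_zero_iff, h0]
  -- The past is constant on A, so Jensen applies to the single concave function `bellman φ ψ (P
  -- ξ)`.
  have hJ := (concaveOn_bellman hφm hφ0 hφ hψ hψc (P ξ)).le_map_set_average (μ := ν) (t := A)
    (continuous_bellman hφm hφ0 hφ hψ hψc (P ξ)).continuousOn isClosed_univ h0
    (measure_ne_top _ _) (by simp)
    (f := ν[f | SimpleFunc.sigmaAlgebra T']) integrable_condExp.integrableOn
    ((hi'.integrableOn (s := A)).congr_fun (fun η hη => by simp [(hc η hη).1]) hAm)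
  rw [havg, setAverage_eq, smul_eq_mul, inv_mul_le_iff₀] at hJ
  · calc _ = ∫ η in A, bellman φ ψ (P ξ) ((ν[f | SimpleFunc.sigmaAlgebra T']) η) ∂ν :=
          setIntegral_congr_fun hAm fun η hη => by simp only [(hc η hη).1]
      _ ≤ ∫ _ in A, bellman φ ψ (P ξ) ((ν[f | SimpleFunc.sigmaAlgebra T]) ξ) ∂ν := by
          rw [setIntegral_const]
          exact hJ
      _ = _ := setIntegral_congr_fun hAm fun η hη => by simp only [(hc η hη).1, (hc η hη).2]
  · exact ENNReal.toReal_pos h0 (measure_ne_top _ _)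

/-- The mean of the Bellman function starts at most 0 by `hgain`, decreases in time, and dominates
the mean of φ - ψ at the final time. -/
theorem integral_le_of_simple_martingale (hφm : Monotone φ) (hφ0 : ∀ S, 0 ≤ φ S)
    (hφ : ∀ S, φ S ≤ B) (hψ : ∀ x, 0 ≤ ψ x) (hψc : Continuous ψ)
    (hgain : ∀ t, BinTree.gain φ ψ ∅ t ≤ 0) (hf : Integrable f ν) (T : ℕ → SimpleFunc Ω γ)
    (hT : ∀ n, (T n : Ω → γ).FactorsThrough (T (n + 1))) (n : ℕ) :
    ∫ ξ, φ ((fun i => (ν[f | SimpleFunc.sigmaAlgebra (T i)]) ξ) '' Iic n) ∂ν ≤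
      ∫ ξ, ψ ((ν[f | SimpleFunc.sigmaAlgebra (T n)]) ξ) ∂ν := by
  set h : ℕ → Ω → X := fun i => ν[f | SimpleFunc.sigmaAlgebra (T i)] with hh
  set P : ℕ → Ω → Set X := fun n ξ => (fun i => h i ξ) '' Iic n with hPdef
  have hTle : ∀ m, ∀ i ≤ m, (T i : Ω → γ).FactorsThrough (T m) := by
    intro m
    induction m with
    | zero => intro i hi; obtain rfl : i = 0 := by omega
              exact fun a b hab => hab
    | succ m ih =>
      intro i hi
      rcases Nat.of_le_succ hi with h' | rfl
      · exact fun a b hab => ih i h' (hT m hab)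
      · exact fun a b hab => hab
  have hhT : ∀ i, (h i).FactorsThrough (T i) := fun i => SimpleFunc.condExp_factorsThrough (T i) f
  have hP : ∀ m, (P m).FactorsThrough (T m) := fun m a b hab =>
    image_congr fun i hi => hhT i (hTle m i hi hab)
  have hPs : ∀ m ξ, P (m + 1) ξ = insert (h (m + 1) ξ) (P m ξ) := by
    intro m ξ
    have : Iic (m + 1) = insert (m + 1) (Iic m) := by
      ext i
      simp only [mem_Iic, mem_insert_iff]
      omega
    simp only [hPdef, this, image_insert_eq]
  have hdec : ∀ m, ∫ ξ, bellman φ ψ (P m ξ) (h m ξ) ∂ν ≤ 0 := by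
    intro m
    induction m with
    | zero =>
      refine integral_nonpos fun ξ => ?_
      have : P 0 ξ = insert (h 0 ξ) ∅ := by
        have : Iic 0 = {0} := by ext i; simp
        simp only [hPdef, this, image_singleton, insert_empty_eq]
      simp only [this, bellman_insert]
      exact bellman_le fun t _ => hgain t
    | succ m ih =>
      refine le_trans ?_ ih
      -- The new value is dropped from the past, leaving a past that depends only on `T m`, as the
      -- one-step estimate requires.
      simp only [hPs, bellman_insert]
      exact integral_bellman_condExp_le hφm hφ0 hφ hψ hψc hf _ _ (hT m) (hP m)
  have hle : ∫ ξ, (φ (P n ξ) - ψ (h n ξ)) ∂ν ≤ ∫ ξ, bellman φ ψ (P n ξ) (h n ξ) ∂ν := by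
    refine integral_mono
      (SimpleFunc.integrable_of_factorsThrough (T := T n) fun a b hab => by
        simp only [hP n hab, hhT n hab])
      (SimpleFunc.integrable_of_factorsThrough (T := T n) fun a b hab => by
        simp only [hP n hab, hhT n hab]) fun ξ => ?_
    have := sub_le_bellman hφ hψ (P n ξ) (h n ξ)
    rwa [insert_eq_of_mem (show h n ξ ∈ P n ξ from ⟨n, by simp, rfl⟩)] at this
  rw [integral_sub
    (SimpleFunc.integrable_of_factorsThrough (T := T n) fun a b hab => by simp only [hP n hab])
    (SimpleFunc.integrable_of_factorsThrough (T := T n) fun a b hab => by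
      simp only [hhT n hab])] at hle
  linarith [hdec n]

end SimpleMartingale

/-! ### Approximation by simple martingales -/

section Approximation

variable {Ω γ X : Type*} {mΩ : MeasurableSpace Ω} {ν : Measure Ω}

theorem stronglyMeasurable_pi_fin [TopologicalSpace X] {n : ℕ} {g : Fin n → Ω → X}
    (hg : ∀ i, StronglyMeasurable (g i)) : StronglyMeasurable fun ξ i => g i ξ := by
  induction n with
  | zero =>
    have : (fun ξ i => g i ξ) = fun _ : Ω => (Fin.elim0 : Fin 0 → X) := by
      ext ξ i; exact i.elim0
    rw [this]
    exact stronglyMeasurable_const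
  | succ n ih =>
    have h : (fun ξ i => g i ξ) = fun ξ =>
        (Fin.cons (g 0 ξ) fun i : Fin n => g i.succ ξ : Fin (n + 1) → X) := by
      ext ξ i
      refine Fin.cases ?_ (fun j => ?_) i <;> simp
    rw [h]
    have hc : Continuous fun q : X × (Fin n → X) => (Fin.cons q.1 q.2 : Fin (n + 1) → X) := by
      refine continuous_pi fun i => ?_
      refine Fin.cases ?_ (fun j => ?_) i
      · simpa using continuous_fst
      · simpa using! (continuous_apply j).comp continuous_snd
    exact hc.comp_stronglyMeasurable ((hg 0).prodMk (ih fun i => hg i.succ))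

theorem measurable_comp_of_lowerSemicontinuous {Y : Type*} [TopologicalSpace Y]
    [TopologicalSpace.PseudoMetrizableSpace Y] {F : Y → ℝ≥0∞} (hF : LowerSemicontinuous F)
    {g : Ω → Y} (hg : StronglyMeasurable g) : Measurable fun ξ => F (g ξ) := by
  borelize Y
  exact hF.measurable.comp hg.measurable

/-- The values of `s n, …, s 0`. -/
def history (s : ℕ → Ω → X) : ℕ → Ω → List X
  | 0, ξ => [s 0 ξ]
  | n + 1, ξ => s (n + 1) ξ :: history s n ξ

theorem history_factorsThrough_succ (s : ℕ → Ω → X) (n : ℕ) :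
    (history s n).FactorsThrough (history s (n + 1)) :=
  fun _ _ hab => (List.cons.inj hab).2

theorem factorsThrough_history (s : ℕ → Ω → X) (n : ℕ) : (s n).FactorsThrough (history s n) := by
  intro a b hab
  cases n with
  | zero => exact (List.cons.inj hab).1
  | succ n => exact (List.cons.inj hab).1

theorem finite_range_history {s : ℕ → Ω → X} (hs : ∀ n, (range (s n)).Finite) (n : ℕ) :
    (range (history s n)).Finite := by
  induction n with
  | zero =>
    refine ((hs 0).image fun x => [x]).subset ?_
    rintro _ ⟨ξ, rfl⟩
    exact ⟨_, ⟨ξ, rfl⟩, rfl⟩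
  | succ n ih =>
    refine (Set.Finite.image2 List.cons (hs (n + 1)) ih).subset ?_
    rintro _ ⟨ξ, rfl⟩
    exact ⟨_, ⟨ξ, rfl⟩, _, ⟨ξ, rfl⟩, rfl⟩

theorem measurableSet_fiber_history {F : ℕ → MeasurableSpace Ω} (hF : Monotone F) {s : ℕ → Ω → X}
    (hs : ∀ n x, MeasurableSet[F n] (s n ⁻¹' {x})) (n : ℕ) (l : List X) :
    MeasurableSet[F n] (history s n ⁻¹' {l}) := by
  have hcons : ∀ {m : MeasurableSpace Ω} {t : Ω → X} {T : Ω → List X},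
      (∀ x, MeasurableSet[m] (t ⁻¹' {x})) → (∀ l, MeasurableSet[m] (T ⁻¹' {l})) →
      ∀ l, MeasurableSet[m] ((fun ξ => t ξ :: T ξ) ⁻¹' {l}) := by
    rintro m t T ht hT (_ | ⟨x, l⟩)
    · convert MeasurableSet.empty
      ext; simp
    · convert (ht x).inter (hT l)
      ext; simp
  induction n generalizing l with
  | zero =>
    refine hcons (T := fun _ => []) (hs 0) (fun l => ?_) l
    exact @measurable_const _ _ ⊤ (F 0) [] _ trivial
  | succ n ih => exact hcons (hs (n + 1)) (fun l => hF n.le_succ _ (ih l)) l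

theorem measurableSet_preimage_of_finite_range {m : MeasurableSpace Ω} {T : Ω → γ}
    (hfin : (range T).Finite) (hT : ∀ y, MeasurableSet[m] (T ⁻¹' {y})) (S : Set γ) :
    MeasurableSet[m] (T ⁻¹' S) :=
  SimpleFunc.measurableSet_preimage ⟨T, hT, hfin⟩ S

theorem stronglyMeasurable_of_finite_range [TopologicalSpace X] {m : MeasurableSpace Ω} {s : Ω → X}
    (hfin : (range s).Finite) (hs : ∀ y, MeasurableSet[m] (s ⁻¹' {y})) : StronglyMeasurable[m] s :=
  SimpleFunc.stronglyMeasurable ⟨s, hs, hfin⟩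

theorem preimage_eq_preimage_image_of_factorsThrough {T : Ω → γ} {s : Ω → X}
    (h : s.FactorsThrough T) (S : Set X) : T ⁻¹' (T '' (s ⁻¹' S)) = s ⁻¹' S := by
  ext η
  constructor
  · rintro ⟨ζ, hζ, hζη⟩
    simpa [← h hζη] using hζ
  · exact fun hη => ⟨η, hη, rfl⟩

variable [NormedAddCommGroup X]

/-- Simple functions are dense in L^p of the trimmed measure, which makes the approximant measurable
for the smaller σ-algebra. -/
theorem exists_finite_range_eLpNorm_sub_le {m : MeasurableSpace Ω} (hm : m ≤ mΩ) {p : ℝ≥0∞}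
    (hp : p ≠ ∞) {g : Ω → X} (hgm : StronglyMeasurable[m] g) (hg : MemLp g p ν) {ε : ℝ≥0∞}
    (hε : ε ≠ 0) : ∃ s : Ω → X, (range s).Finite ∧ (∀ x, MeasurableSet[m] (s ⁻¹' {x})) ∧
      eLpNorm (g - s) p ν ≤ ε ∧ MemLp s p ν := by
  have hg' : MemLp g p (ν.trim hm) := ⟨hgm.aestronglyMeasurable, by
    rw [eLpNorm_trim hm hgm]; exact hg.2⟩
  obtain ⟨s, hs, hsm⟩ := hg'.exists_simpleFunc_eLpNorm_sub_lt hp hε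
  refine ⟨_, s.finite_range', s.measurableSet_fiber', ?_, memLp_of_memLp_trim hm hsm⟩
  have hsub : StronglyMeasurable[m] (g - s.toFun) :=
    hgm.sub (stronglyMeasurable_of_finite_range s.finite_range' s.measurableSet_fiber')
  rw [← eLpNorm_trim hm hsub]
  exact hs.le

theorem TendstoInMeasure.pi_fin {n : ℕ} {g : ℕ → Fin n → Ω → X} {g' : Fin n → Ω → X}
    (h : ∀ i, TendstoInMeasure ν (fun k => g k i) atTop (g' i)) :
    TendstoInMeasure ν (fun k ξ i => g k i ξ) atTop fun ξ i => g' i ξ := by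
  intro ε hε
  have hsum : Tendsto (fun k => ∑ i, ν {ξ | ε ≤ edist (g k i ξ) (g' i ξ)}) atTop (𝓝 0) := by
    simpa using tendsto_finsetSum Finset.univ fun i _ => h i ε hε
  refine tendsto_of_tendsto_of_tendsto_of_le_of_le tendsto_const_nhds hsum
    (fun _ => zero_le) fun k => ?_
  refine le_trans (measure_mono ?_) (measure_iUnion_fintype_le ν _)
  intro ξ hξ
  by_contra hcon
  simp only [mem_iUnion, mem_ofPred_eq, not_exists, not_le] at hcon hξ
  refine hξ.not_gt ?_
  rw [edist_pi_def, Finset.sup_lt_iff (by simpa using hε)]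
  exact fun i _ => hcon i

variable [NormedSpace ℝ X] [CompleteSpace X] [IsFiniteMeasure ν]

/-- Conditioning on m' fixes s, so the difference is 𝔼(g | m') - g with g = 𝔼(f | m) - s.
Contractivity of the conditional expectation in L^p gives the factor 2. -/
theorem eLpNorm_condExp_sub_condExp_le {m m' : MeasurableSpace Ω} (hm' : m' ≤ m) (hm : m ≤ mΩ)
    {p : ℝ≥0∞} (hp : 1 ≤ p) {f s : Ω → X} (hs : StronglyMeasurable[m'] s)
    (hsp : MemLp s p ν) :
    eLpNorm (ν[f | m'] - ν[f | m]) p ν ≤ 2 * eLpNorm (ν[f | m] - s) p ν := by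
  have hsi := hsp.integrable hp
  have h1 : ν[f | m'] - ν[f | m] =ᵐ[ν] ν[ν[f | m] - s | m'] - (ν[f | m] - s) := by
    have h2 := condExp_condExp_of_le (f := f) (μ := ν) hm' hm
    have h3 := condExp_sub (μ := ν) (f := ν[f | m]) (g := s) integrable_condExp hsi m'
    rw [condExp_of_stronglyMeasurable (hm'.trans hm) hs hsi] at h3
    filter_upwards [h2, h3] with ξ h2 h3
    simp only [Pi.sub_apply, h3, h2]
    abel
  have hae : AEStronglyMeasurable[mΩ] (ν[f | m] - s) ν :=
    (integrable_condExp (m := m) (f := f)).aestronglyMeasurable.sub hsp.1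
  rw [eLpNorm_congr_ae h1, two_mul]
  exact (eLpNorm_sub_le integrable_condExp.aestronglyMeasurable hae hp).trans
    (add_le_add_left (eLpNorm_condExp_le_eLpNorm _ hp) _)

/-- A finite martingale is approximated by martingales generated by simple functions. -/
theorem exists_simple_approx {F : ℕ → MeasurableSpace Ω} (hF : Monotone F)
    (hle : ∀ n, F n ≤ mΩ) {p : ℝ≥0∞} (hp : 1 ≤ p) (hp' : p ≠ ∞) {f : Ω → X} (hf : MemLp f p ν)
    {ε : ℝ≥0∞} (hε : ε ≠ 0) :
    ∃ T : ℕ → SimpleFunc Ω (List X),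
      (∀ n, (T n : Ω → List X).FactorsThrough (T (n + 1))) ∧
      ∀ n, eLpNorm (ν[f | SimpleFunc.sigmaAlgebra (T n)] - ν[f | F n]) p ν ≤ 2 * ε := by
  choose s hfin hfib hs hsp using fun n => exists_finite_range_eLpNorm_sub_le (hle n) hp'
    (stronglyMeasurable_condExp (μ := ν) (f := f)) (hf.condExp hp) hε
  have hTfin := finite_range_history hfin
  have hTfib := measurableSet_fiber_history hF hfib
  -- The approximants `s n` alone need not generate an increasing family of σ-algebras; their
  -- histories do, while remaining `F n`-measurable.
  refine ⟨fun n => ⟨history s n, fun l => hle n _ (hTfib n l), hTfin n⟩,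
    history_factorsThrough_succ s, fun n => ?_⟩
  refine (eLpNorm_condExp_sub_condExp_le ?_ (hle n) hp ?_ (hsp n)).trans (by gcongr; exact hs n)
  · rintro _ ⟨S, -, rfl⟩
    exact measurableSet_preimage_of_finite_range (hTfin n) (hTfib n) S
  · refine stronglyMeasurable_of_finite_range (hfin n) fun y =>
      ⟨history s n '' (s n ⁻¹' {y}), trivial, ?_⟩
    exact preimage_eq_preimage_image_of_factorsThrough (factorsThrough_history s n) {y}

variable {φ : Set X → ℝ≥0∞} {B : ℝ≥0} {c : ℝ≥0}

/-- The inequality for dyadic martingales carries over to finite martingales on finite measure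
spaces. -/
theorem lintegral_condExp_le (hφm : Monotone φ) (hφ : ∀ S, φ S ≤ B)
    (hlsc : ∀ n, LowerSemicontinuous fun a : Fin n → X => φ (range a)) {p : ℝ≥0∞} (hp : 1 ≤ p)
    (hp' : p ≠ ∞)
    (hgain : ∀ t, BinTree.gain (fun S => (φ S).toReal) (fun x => c * ‖x‖ ^ p.toReal) ∅ t ≤ 0)
    {F : ℕ → MeasurableSpace Ω} (hF : Monotone F) (hle : ∀ n, F n ≤ mΩ) {f : Ω → X}
    (hf : MemLp f p ν) (n : ℕ) :
    ∫⁻ ξ, φ (range fun i : Fin (n + 1) => (ν[f | F i]) ξ) ∂ν ≤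
      c * ∫⁻ ξ, ‖f ξ‖ₑ ^ p.toReal ∂ν := by
  have hp0 : p ≠ 0 := (zero_lt_one.trans_le hp).ne'
  have hq : 0 < p.toReal := ENNReal.toReal_pos hp0 hp'
  have hfin : ∀ S, φ S ≠ ∞ := fun S => ((hφ S).trans_lt ENNReal.coe_lt_top).ne
  have hfi := hf.integrable hp
  choose T hT hTε using fun k : ℕ => exists_simple_approx hF hle hp hp' hf
    (ε := ((k : ℝ≥0∞) + 1)⁻¹) (by simp)
  set h : ℕ → Fin (n + 1) → Ω → X := fun k i => ν[f | SimpleFunc.sigmaAlgebra (T k i)] with hh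
  have hε : Tendsto (fun k : ℕ => 2 * ((k : ℝ≥0∞) + 1)⁻¹) atTop (𝓝 0) := by
    have : Tendsto (fun k : ℕ => ((k : ℝ≥0∞) + 1)⁻¹) atTop (𝓝 0) := by
      simpa using (tendsto_add_atTop_iff_nat 1).2 ENNReal.tendsto_inv_nat_nhds_zero
    simpa using ENNReal.Tendsto.const_mul this (Or.inr (by simp : (2 : ℝ≥0∞) ≠ ∞))
  have hmeas : TendstoInMeasure ν (fun k ξ i => h k i ξ) atTop
      fun ξ (i : Fin (n + 1)) => (ν[f | F i]) ξ := by
    refine TendstoInMeasure.pi_fin fun i => ?_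
    refine tendstoInMeasure_of_tendsto_eLpNorm hp0
      (fun k => integrable_condExp.aestronglyMeasurable) integrable_condExp.aestronglyMeasurable ?_
    exact tendsto_of_tendsto_of_tendsto_of_le_of_le tendsto_const_nhds hε
      (fun _ => zero_le) fun k => hTε k i
  -- The finitely many times are treated as one vector, so one subsequence serves all of them.
  obtain ⟨ns, -, hns⟩ := hmeas.exists_seq_tendsto_ae
  have hbound : ∀ k, ∫⁻ ξ, φ (range fun i => h k i ξ) ∂ν ≤ c * ∫⁻ ξ, ‖f ξ‖ₑ ^ p.toReal ∂ν := by
    intro k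
    have key := integral_le_of_simple_martingale (ν := ν) (φ := fun S => (φ S).toReal)
      (ψ := fun x => c * ‖x‖ ^ p.toReal) (B := B)
      (fun S S' hS => ENNReal.toReal_mono (hfin _) (hφm hS)) (fun _ => ENNReal.toReal_nonneg)
      (fun S => ENNReal.toReal_le_of_le_ofReal B.2 (by simpa using hφ S)) (fun x => by positivity)
      (by fun_prop (disch := positivity)) hgain hfi (T k) (hT k) n
    have hrange : ∀ ξ, (fun i => (ν[f | SimpleFunc.sigmaAlgebra (T k i)]) ξ) '' Iic n =
        range fun i => h k i ξ := by
      intro ξ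
      ext x
      simp only [mem_image, mem_Iic, mem_range, hh]
      constructor
      · rintro ⟨i, hi, rfl⟩
        exact ⟨⟨i, by omega⟩, rfl⟩
      · rintro ⟨i, rfl⟩
        exact ⟨i, by omega, rfl⟩
    simp only [hrange] at key
    have hmeasφ : Measurable fun ξ => φ (range fun i => h k i ξ) :=
      measurable_comp_of_lowerSemicontinuous (hlsc (n + 1)) (stronglyMeasurable_pi_fin fun i =>
        stronglyMeasurable_condExp.mono (SimpleFunc.sigmaAlgebra_le _))
    have hint : MemLp (ν[f | SimpleFunc.sigmaAlgebra (T k n)]) p ν := hf.condExp hp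
    rw [integral_toReal hmeasφ.aemeasurable (ae_of_all _ fun ξ => (hfin _).lt_top),
      integral_const_mul] at key
    have hI : ENNReal.ofReal (∫ ξ, ‖(ν[f | SimpleFunc.sigmaAlgebra (T k n)]) ξ‖ ^ p.toReal ∂ν) =
        ∫⁻ ξ, ‖(ν[f | SimpleFunc.sigmaAlgebra (T k n)]) ξ‖ₑ ^ p.toReal ∂ν := by
      rw [ofReal_integral_eq_lintegral_ofReal (hint.integrable_norm_rpow hp0 hp')
        (ae_of_all _ fun ξ => by positivity)]
      refine lintegral_congr fun ξ => ?_
      rw [← ENNReal.ofReal_rpow_of_nonneg (norm_nonneg _) hq.le, ofReal_norm]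
    have hne : ∫⁻ ξ, φ (range fun i => h k i ξ) ∂ν ≠ ∞ := by
      refine ((lintegral_mono fun ξ => hφ _).trans_lt ?_).ne
      rw [lintegral_const]
      exact ENNReal.mul_lt_top ENNReal.coe_lt_top (measure_lt_top _ _)
    calc _ = ENNReal.ofReal (∫⁻ ξ, φ (range fun i => h k i ξ) ∂ν).toReal :=
          (ENNReal.ofReal_toReal hne).symm
      _ ≤ _ := ENNReal.ofReal_le_ofReal key
      _ = c * ∫⁻ ξ, ‖(ν[f | SimpleFunc.sigmaAlgebra (T k n)]) ξ‖ₑ ^ p.toReal ∂ν := by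
          rw [ENNReal.ofReal_mul (NNReal.coe_nonneg c), hI, ENNReal.ofReal_coe_nnreal]
      _ ≤ _ := by
          refine mul_le_mul_right ?_ _
          have := eLpNorm_condExp_le_eLpNorm (μ := ν) (m := SimpleFunc.sigmaAlgebra (T k n)) f hp
          rw [eLpNorm_eq_lintegral_rpow_enorm_toReal hp0 hp',
            eLpNorm_eq_lintegral_rpow_enorm_toReal hp0 hp'] at this
          exact (ENNReal.rpow_le_rpow_iff (by positivity)).1 this
  -- Lower semicontinuity of φ along the a.e. convergent subsequence, then Fatou.
  calc ∫⁻ ξ, φ (range fun i : Fin (n + 1) => (ν[f | F i]) ξ) ∂ν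
      ≤ ∫⁻ ξ, liminf (fun k => φ (range fun i => h (ns k) i ξ)) atTop ∂ν := by
        refine lintegral_mono_ae ?_
        filter_upwards [hns] with ξ hξ
        refine ((hlsc (n + 1)).le_liminf _).trans ?_
        exact liminf_le_liminf_of_le hξ
    _ ≤ liminf (fun k => ∫⁻ ξ, φ (range fun i => h (ns k) i ξ) ∂ν) atTop := by
        refine lintegral_liminf_le fun k => ?_
        exact measurable_comp_of_lowerSemicontinuous (hlsc (n + 1)) (stronglyMeasurable_pi_fin fun i =>
          stronglyMeasurable_condExp.mono (SimpleFunc.sigmaAlgebra_le _))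
    _ ≤ _ := liminf_le_of_le (by isBoundedDefault) fun b hb => by
        obtain ⟨k, hk⟩ := hb.exists
        exact hk.trans (hbound _)

end Approximation

/-! ### Trees as dyadic step functions on [0, 1) -/

section Glue

variable {Y : Type*}

/-- The function on `[0, 1)` that consists of rescaled copies of `a` and `b` on the two halves. -/
noncomputable def glue (a b : ℝ → Y) (x : ℝ) : Y := if x < 1 / 2 then a (2 * x) else b (2 * x - 1)

variable [NormedAddCommGroup Y]

/-- Bounded strongly measurable functions on the real line. -/
def BoundedMeasurable (F : ℝ → Y) : Prop := StronglyMeasurable F ∧ ∃ M, ∀ x, ‖F x‖ ≤ M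

theorem boundedMeasurable_const (y : Y) : BoundedMeasurable fun _ => y :=
  ⟨stronglyMeasurable_const, ‖y‖, fun _ => le_rfl⟩

theorem BoundedMeasurable.glue {a b : ℝ → Y} (ha : BoundedMeasurable a)
    (hb : BoundedMeasurable b) : BoundedMeasurable (glue a b) := by
  obtain ⟨ha, M, hM⟩ := ha
  obtain ⟨hb, N, hN⟩ := hb
  refine ⟨StronglyMeasurable.ite measurableSet_Iio (ha.comp_measurable (by fun_prop))
    (hb.comp_measurable (by fun_prop)), max M N, fun x => ?_⟩
  unfold RademacherMaximal.glue
  split_ifs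
  · exact (hM _).trans (le_max_left _ _)
  · exact (hN _).trans (le_max_right _ _)

theorem BoundedMeasurable.intervalIntegrable {F : ℝ → Y} (hF : BoundedMeasurable F) (u v : ℝ) :
    IntervalIntegrable F volume u v := by
  obtain ⟨hF, M, hM⟩ := hF
  rw [intervalIntegrable_iff]
  exact Measure.integrableOn_of_bounded (M := M) (by simp) hF.aestronglyMeasurable
    (ae_of_all _ hM)

variable [NormedSpace ℝ Y]

theorem integral_glue_left (a b : ℝ → Y) {u v : ℝ} (huv : u ≤ v) (hv : v ≤ 1 / 2) :
    ∫ x in u..v, glue a b x = (2 : ℝ)⁻¹ • ∫ x in (2 * u)..(2 * v), a x := by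
  rw [← intervalIntegral.integral_comp_mul_left _ two_ne_zero, intervalIntegral.integral_of_le huv,
    intervalIntegral.integral_of_le huv, integral_Ioc_eq_integral_Ioo,
    integral_Ioc_eq_integral_Ioo]
  -- The open interval excludes v, which may be 1/2, where `glue` already follows b.
  exact setIntegral_congr_fun measurableSet_Ioo fun x hx => if_pos (hx.2.trans_le hv)

theorem integral_glue_right (a b : ℝ → Y) {u v : ℝ} (huv : u ≤ v) (hu : 1 / 2 ≤ u) :
    ∫ x in u..v, glue a b x = (2 : ℝ)⁻¹ • ∫ x in (2 * u - 1)..(2 * v - 1), b x := by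
  rw [← intervalIntegral.integral_comp_mul_sub _ two_ne_zero, intervalIntegral.integral_of_le huv,
    intervalIntegral.integral_of_le huv, integral_Ioc_eq_integral_Ioo,
    integral_Ioc_eq_integral_Ioo]
  exact setIntegral_congr_fun measurableSet_Ioo fun x hx => if_neg (hu.trans hx.1.le).not_gt

theorem integral_glue {a b : ℝ → Y} (ha : BoundedMeasurable a) (hb : BoundedMeasurable b) :
    ∫ x in (0 : ℝ)..1, glue a b x =
      (1 / 2 : ℝ) • ((∫ x in (0 : ℝ)..1, a x) + ∫ x in (0 : ℝ)..1, b x) := by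
  have h := ha.glue hb
  rw [← intervalIntegral.integral_add_adjacent_intervals (h.intervalIntegrable 0 (1 / 2))
    (h.intervalIntegrable (1 / 2) 1), integral_glue_left a b (by norm_num) le_rfl,
    integral_glue_right a b (by norm_num) le_rfl]
  norm_num

end Glue

namespace BinTree

variable {X : Type*} [NormedAddCommGroup X]

/-- The dyadic step function on `[0, 1)` given by a tree. -/
noncomputable def step : BinTree X → ℝ → X
  | leaf x => fun _ => x
  | node l r => glue (step l) (step r)

theorem boundedMeasurable_step (t : BinTree X) : BoundedMeasurable (step t) := by
  induction t with
  | leaf x => exact boundedMeasurable_const x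
  | node l r hl hr => exact hl.glue hr

variable [NormedSpace ℝ X]

/-- The conditional expectation of `step` with respect to the dyadic intervals of length `2⁻ʲ`. -/
noncomputable def proj : ℕ → BinTree X → ℝ → X
  | 0, t => fun _ => mean t
  | _ + 1, leaf x => fun _ => x
  | j + 1, node l r => glue (proj j l) (proj j r)

theorem boundedMeasurable_proj (j : ℕ) (t : BinTree X) : BoundedMeasurable (proj j t) := by
  induction j generalizing t with
  | zero => exact boundedMeasurable_const _
  | succ j ih =>
    cases t with
    | leaf x => exact boundedMeasurable_const x
    | node l r => exact (ih l).glue (ih r)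

theorem integral_step [CompleteSpace X] (t : BinTree X) : ∫ x in (0 : ℝ)..1, step t x = mean t := by
  induction t with
  | leaf x => simp [step, mean]
  | node l r hl hr =>
    simp only [step, mean]
    rw [integral_glue (boundedMeasurable_step l) (boundedMeasurable_step r), hl, hr]

/-- Induction on the level: k < 2 ^ j selects the left subtree with index k, and otherwise the right
subtree with index k - 2 ^ j. -/
theorem integral_dyadic_step [CompleteSpace X] (j k : ℕ) (hk : k < 2 ^ j) (t : BinTree X) :
    ∫ x in (k / 2 ^ j : ℝ)..((k + 1) / 2 ^ j), step t x =
      ∫ x in (k / 2 ^ j : ℝ)..((k + 1) / 2 ^ j), proj j t x := by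
  induction j generalizing k t with
  | zero =>
    obtain rfl : k = 0 := by simpa using hk
    simp [proj, integral_step]
  | succ j ih =>
    cases t with
    | leaf x => rfl
    | node l r =>
      simp only [step, proj]
      have h2 : (0 : ℝ) < 2 ^ j := by positivity
      have huv : (k / 2 ^ (j + 1) : ℝ) ≤ (k + 1) / 2 ^ (j + 1) := by gcongr; linarith
      rcases lt_or_ge k (2 ^ j) with h | h
      · have hv : ((k + 1) / 2 ^ (j + 1) : ℝ) ≤ 1 / 2 := by
          have : (k : ℝ) + 1 ≤ 2 ^ j := by exact_mod_cast h
          rw [pow_succ, div_le_iff₀ (by positivity)]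
          linarith
        rw [integral_glue_left _ _ huv hv, integral_glue_left _ _ huv hv,
          show (2 * (k / 2 ^ (j + 1)) : ℝ) = k / 2 ^ j by rw [pow_succ]; field_simp,
          show (2 * ((k + 1) / 2 ^ (j + 1)) : ℝ) = (k + 1) / 2 ^ j by rw [pow_succ]; field_simp,
          ih k h l]
      · obtain ⟨i, rfl⟩ := Nat.exists_eq_add_of_le h
        have hi : i < 2 ^ j := by rw [pow_succ] at hk; omega
        have hu : (1 / 2 : ℝ) ≤ (2 ^ j + i : ℕ) / 2 ^ (j + 1) := by
          rw [pow_succ, le_div_iff₀ (by positivity)]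
          push_cast
          linarith [(Nat.cast_nonneg i : (0 : ℝ) ≤ i)]
        rw [integral_glue_right _ _ huv hu, integral_glue_right _ _ huv hu,
          show (2 * ((2 ^ j + i : ℕ) / 2 ^ (j + 1)) - 1 : ℝ) = i / 2 ^ j by
            rw [pow_succ]; push_cast; field_simp; ring,
          show (2 * (((2 ^ j + i : ℕ) + 1) / 2 ^ (j + 1)) - 1 : ℝ) = (i + 1) / 2 ^ j by
            rw [pow_succ]; push_cast; field_simp; ring,
          ih i hi r]

theorem proj_eq_of_mem (j k : ℕ) (t : BinTree X) {x y : ℝ}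
    (hx : x ∈ Ico (k / 2 ^ j : ℝ) ((k + 1) / 2 ^ j))
    (hy : y ∈ Ico (k / 2 ^ j : ℝ) ((k + 1) / 2 ^ j)) : proj j t x = proj j t y := by
  induction j generalizing k t x y with
  | zero => rfl
  | succ j ih =>
    cases t with
    | leaf x => rfl
    | node l r =>
      simp only [proj, glue]
      have h2 : (0 : ℝ) < 2 ^ j := by positivity
      have h3 : (0 : ℝ) < 2 ^ j * 2 := by positivity
      simp only [mem_Ico, pow_succ, div_le_iff₀ h3, lt_div_iff₀ h3] at hx hy
      rcases lt_or_ge k (2 ^ j) with h | h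
      · have hk : (k : ℝ) + 1 ≤ 2 ^ j := by exact_mod_cast h
        rw [if_pos (by nlinarith), if_pos (by nlinarith)]
        apply ih k
        · simp only [mem_Ico, div_le_iff₀ h2, lt_div_iff₀ h2]
          constructor <;> linarith
        · simp only [mem_Ico, div_le_iff₀ h2, lt_div_iff₀ h2]
          constructor <;> linarith
      · obtain ⟨i, rfl⟩ := Nat.exists_eq_add_of_le h
        push_cast at hx hy
        have hi : (0 : ℝ) ≤ i := Nat.cast_nonneg i
        rw [if_neg (by nlinarith), if_neg (by nlinarith)]
        apply ih i
        · simp only [mem_Ico, div_le_iff₀ h2, lt_div_iff₀ h2]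
          constructor <;> linarith
        · simp only [mem_Ico, div_le_iff₀ h2, lt_div_iff₀ h2]
          constructor <;> linarith

theorem range_proj_leaf (x : X) (ξ : ℝ) : (range fun j => proj j (leaf x) ξ) = {x} := by
  have : (fun j => proj j (leaf x) ξ) = fun _ => x := by
    ext j; cases j <;> rfl
  rw [this, range_const]

/-- This is the recursion of `gain`: the root value joins the past, and the path continues in one
half. -/
theorem range_proj_node (l r : BinTree X) (ξ : ℝ) :
    (range fun j => proj j (node l r) ξ) = insert (mean (node l r))
      (glue (fun ξ => range fun j => proj j l ξ) (fun ξ => range fun j => proj j r ξ) ξ) := by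
  have h : glue (fun ξ => range fun j => proj j l ξ) (fun ξ => range fun j => proj j r ξ) ξ =
      range fun j => proj (j + 1) (node l r) ξ := by
    simp only [proj, glue]
    split_ifs <;> rfl
  rw [h]
  ext y
  constructor
  · rintro ⟨_ | j, rfl⟩
    · exact Or.inl rfl
    · exact Or.inr ⟨j, rfl⟩
  · rintro (rfl | ⟨j, rfl⟩)
    · exact ⟨0, rfl⟩
    · exact ⟨j + 1, rfl⟩

/-- The gain of a tree is the integral of the gain along the paths. -/
theorem integral_gain (φ : Set X → ℝ) (ψ : X → ℝ) (S : Set X) (t : BinTree X) :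
    BoundedMeasurable (fun ξ => φ ((range fun j => proj j t ξ) ∪ S) - ψ (step t ξ)) ∧
    ∫ ξ in (0 : ℝ)..1, (φ ((range fun j => proj j t ξ) ∪ S) - ψ (step t ξ)) = gain φ ψ S t := by
  induction t generalizing S with
  | leaf x =>
    simp only [range_proj_leaf, step, gain, singleton_union]
    exact ⟨boundedMeasurable_const _, by simp⟩
  | node l r hl hr =>
    obtain ⟨hl₁, hl₂⟩ := hl (insert (mean (node l r)) S)
    obtain ⟨hr₁, hr₂⟩ := hr (insert (mean (node l r)) S)
    have h : (fun ξ => φ ((range fun j => proj j (node l r) ξ) ∪ S) - ψ (step (node l r) ξ)) =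
        glue (fun ξ => φ ((range fun j => proj j l ξ) ∪ insert (mean (node l r)) S) - ψ (step l ξ))
          (fun ξ => φ ((range fun j => proj j r ξ) ∪ insert (mean (node l r)) S) -
            ψ (step r ξ)) := by
      ext ξ
      simp only [range_proj_node, step, insert_union, union_insert]
      unfold glue
      split_ifs <;> rfl
    rw [h]
    refine ⟨hl₁.glue hr₁, ?_⟩
    rw [integral_glue hl₁ hr₁, hl₂, hr₂, gain, smul_eq_mul]
    ring

end BinTree

/-! ### Conditional expectations for the dyadic filtration -/

section Dyadic

instance isProbabilityMeasure_unitIntervalMeasure : IsProbabilityMeasure unitIntervalMeasure := by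
  constructor
  rw [unitIntervalMeasure, Measure.comap_apply _ Subtype.val_injective
    (fun s hs => (MeasurableEmbedding.subtype_coe measurableSet_Ico).measurableSet_image' hs) _
    MeasurableSet.univ, image_univ, Subtype.range_coe_subtype]
  exact Real.volume_Ico.trans (by simp)

theorem map_unitIntervalMeasure :
    unitIntervalMeasure.map Subtype.val = volume.restrict (Ico (0 : ℝ) 1) :=
  map_comap_subtype_coe measurableSet_Ico volume

theorem lintegral_unitIntervalMeasure (F : ℝ → ℝ≥0∞) :
    ∫⁻ ξ, F (ξ : ℝ) ∂unitIntervalMeasure = ∫⁻ x in Ico (0 : ℝ) 1, F x := by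
  rw [← map_unitIntervalMeasure,
    (MeasurableEmbedding.subtype_coe measurableSet_Ico).lintegral_map]

theorem dyadicInterval_eq (j k : ℕ) :
    dyadicInterval j k = Subtype.val ⁻¹' Ico (k / 2 ^ j : ℝ) ((k + 1) / 2 ^ j) := rfl

theorem measurableSet_dyadicInterval (j k : ℕ) : MeasurableSet (dyadicInterval j k) :=
  measurable_subtype_coe measurableSet_Ico

theorem setIntegral_dyadicInterval {X : Type*} [NormedAddCommGroup X] [NormedSpace ℝ X]
    {j k : ℕ} (hk : k < 2 ^ j) (F : ℝ → X) :
    ∫ ξ in dyadicInterval j k, F ξ ∂unitIntervalMeasure =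
      ∫ x in (k / 2 ^ j : ℝ)..((k + 1) / 2 ^ j), F x := by
  have h2 : (0 : ℝ) < 2 ^ j := by positivity
  have hk' : (k : ℝ) + 1 ≤ 2 ^ j := by exact_mod_cast hk
  rw [dyadicInterval_eq, ← (MeasurableEmbedding.subtype_coe measurableSet_Ico).setIntegral_map,
    map_unitIntervalMeasure, Measure.restrict_restrict measurableSet_Ico,
    inter_eq_self_of_subset_left, intervalIntegral.integral_of_le (by gcongr; linarith),
    integral_Ioc_eq_integral_Ioo, integral_Ico_eq_integral_Ioo]
  exact Ico_subset_Ico (by positivity) ((div_le_one h2).2 hk')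

/-- The number of the dyadic interval of length `2⁻ʲ` that contains a point. -/
noncomputable def dyadicIndex (j : ℕ) (x : Ico (0 : ℝ) 1) : ℕ := ⌊(x : ℝ) * 2 ^ j⌋₊

theorem dyadicIndex_preimage (j k : ℕ) : dyadicIndex j ⁻¹' {k} = dyadicInterval j k := by
  have h2 : (0 : ℝ) < 2 ^ j := by positivity
  ext x
  have hx := x.2.1
  simp only [dyadicIndex, mem_preimage, mem_singleton_iff, dyadicInterval, mem_ofPred_eq,
    div_le_iff₀ h2, lt_div_iff₀ h2]
  rw [Nat.floor_eq_iff (by positivity)]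

theorem dyadicIndex_lt (j : ℕ) (x : Ico (0 : ℝ) 1) : dyadicIndex j x < 2 ^ j := by
  have hx := x.2.2
  rw [dyadicIndex, Nat.floor_lt (mul_nonneg x.2.1 (by positivity))]
  push_cast
  have h2 : (0 : ℝ) < 2 ^ j := by positivity
  nlinarith

theorem exists_eq_preimage_dyadicIndex {j : ℕ} {A : Set (Ico (0 : ℝ) 1)}
    (hA : MeasurableSet[dyadicAlgebra j] A) : ∃ S : Set ℕ, dyadicIndex j ⁻¹' S = A := by
  have hle : dyadicAlgebra j ≤ MeasurableSpace.comap (dyadicIndex j) ⊤ := by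
    refine MeasurableSpace.generateFrom_le ?_
    rintro _ ⟨k, -, rfl⟩
    exact ⟨{k}, trivial, dyadicIndex_preimage j k⟩
  obtain ⟨S, -, hS⟩ := hle A hA
  exact ⟨S, hS⟩

theorem measurableSet_dyadicIndex_preimage (j : ℕ) (S : Set ℕ) :
    MeasurableSet[dyadicAlgebra j] (dyadicIndex j ⁻¹' S) := by
  have hfin : (range (dyadicIndex j)).Finite :=
    (finite_lt_nat (2 ^ j)).subset (by rintro _ ⟨x, rfl⟩; exact dyadicIndex_lt j x)
  refine measurableSet_preimage_of_finite_range hfin (fun k => ?_) S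
  rcases lt_or_ge k (2 ^ j) with hk | hk
  · rw [dyadicIndex_preimage]
    exact MeasurableSpace.measurableSet_generateFrom ⟨k, hk, rfl⟩
  · convert @MeasurableSet.empty _ (dyadicAlgebra j)
    ext x
    simpa using ((dyadicIndex_lt j x).trans_le hk).ne

variable {X : Type*} [NormedAddCommGroup X]

theorem BoundedMeasurable.memLp {F : ℝ → X} (hF : BoundedMeasurable F) (p : ℝ≥0∞) :
    MemLp (fun ξ : Ico (0 : ℝ) 1 => F ξ) p unitIntervalMeasure := by
  obtain ⟨hF, M, hM⟩ := hF
  exact MemLp.of_bound (hF.comp_measurable measurable_subtype_coe).aestronglyMeasurable M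
    (ae_of_all _ fun ξ => hM ξ)

variable [NormedSpace ℝ X] [CompleteSpace X]

/-- The dyadic algebra consists of the preimages under `dyadicIndex`, so each of its sets is a
finite disjoint union of dyadic intervals, and those are handled by `integral_dyadic_step`. -/
theorem isCondExp_proj (j : ℕ) (t : BinTree X) :
    IsCondExp (dyadicAlgebra j) unitIntervalMeasure (fun ξ => t.step ξ)
      (fun ξ => BinTree.proj j t ξ) := by
  have hint := ((BinTree.boundedMeasurable_proj j t).memLp 1).integrable le_rfl
  have hint' := ((BinTree.boundedMeasurable_step t).memLp 1).integrable le_rfl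
  have hfac : (fun ξ : Ico (0 : ℝ) 1 => BinTree.proj j t ξ).FactorsThrough (dyadicIndex j) := by
    intro x y hxy
    have hx : x ∈ dyadicInterval j (dyadicIndex j x) := by rw [← dyadicIndex_preimage]; rfl
    have hy : y ∈ dyadicInterval j (dyadicIndex j x) := by
      rw [← dyadicIndex_preimage]; exact hxy.symm
    exact BinTree.proj_eq_of_mem j _ t hx hy
  refine ⟨?_, fun A _ _ => hint.integrableOn, fun A hA _ => ?_⟩
  · refine stronglyMeasurable_of_finite_range ?_ fun y => ?_
    · obtain ⟨g, hg⟩ : ∃ g : ℕ → X, (fun ξ : Ico (0 : ℝ) 1 => BinTree.proj j t ξ) =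
          g ∘ dyadicIndex j := ⟨_, (hfac.extend_comp fun _ => 0).symm⟩
      rw [hg, range_comp]
      exact ((finite_lt_nat (2 ^ j)).subset
        (by rintro _ ⟨x, rfl⟩; exact dyadicIndex_lt j x)).image g
    · rw [← preimage_eq_preimage_image_of_factorsThrough hfac]
      exact measurableSet_dyadicIndex_preimage j _
  · classical
    obtain ⟨S, rfl⟩ := exists_eq_preimage_dyadicIndex hA
    have hU : dyadicIndex j ⁻¹' S =
        ⋃ k ∈ (Finset.range (2 ^ j)).filter (· ∈ S), dyadicInterval j k := by
      ext x
      simp only [← dyadicIndex_preimage, mem_preimage, Finset.mem_filter, Finset.mem_range,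
        mem_iUnion, mem_singleton_iff, exists_prop, exists_eq_right', dyadicIndex_lt, true_and]
    have hd : Pairwise (Function.onFun Disjoint (dyadicInterval j)) := by
      intro k l hkl
      simp only [Function.onFun, ← dyadicIndex_preimage]
      exact Disjoint.preimage _ (by simpa using hkl)
    rw [hU, integral_biUnion_finset _ (fun k _ => measurableSet_dyadicInterval j k)
        (hd.set_pairwise _) (fun k _ => hint.integrableOn),
      integral_biUnion_finset _ (fun k _ => measurableSet_dyadicInterval j k)
        (hd.set_pairwise _) (fun k _ => hint'.integrableOn)]
    refine Finset.sum_congr rfl fun k hk => ?_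
    have hk' : k < 2 ^ j := Finset.mem_range.1 (Finset.mem_filter.1 hk).1
    rw [setIntegral_dyadicInterval hk', setIntegral_dyadicInterval hk',
      BinTree.integral_dyadic_step j k hk']

theorem sigmaCondExp_step_ae_eq (t : BinTree X) :
    ∀ᵐ ξ ∂unitIntervalMeasure, ∀ j,
      sigmaCondExp (dyadicFiltration j) unitIntervalMeasure (fun ξ => t.step ξ) ξ =
        BinTree.proj j t ξ := by
  rw [ae_all_iff]
  intro j
  have hm := dyadicFiltration.le j
  exact (isCondExp_sigmaCondExp hm le_rfl ((BinTree.boundedMeasurable_step t).memLp 1)).ae_eq hm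
    (isCondExp_proj j t)

end Dyadic

/-! ### Truncated powers of the R-bound -/

section Truncation

variable {𝕜 H E X : Type*} [RCLike 𝕜] [NormedAddCommGroup H] [NormedSpace 𝕜 H]
  [NormedAddCommGroup E] [NormedSpace 𝕜 E]

/-- The `q`-th power of the R-bound, truncated at `M`. -/
noncomputable def truncRBound (J : X → H →L[𝕜] E) (q : ℝ) (M : ℝ≥0) (S : Set X) : ℝ≥0∞ :=
  min (rBound (J '' S)) M ^ q

variable {J : X → H →L[𝕜] E} {q : ℝ} {M : ℝ≥0}

theorem truncRBound_mono (hq : 0 ≤ q) : Monotone (truncRBound J q M) := fun _ _ h =>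
  ENNReal.rpow_le_rpow (min_le_min_right _ (rBound_mono (image_mono h))) hq

theorem truncRBound_le (hq : 0 ≤ q) (S : Set X) : truncRBound J q M S ≤ (M ^ q : ℝ≥0) := by
  rw [ENNReal.coe_rpow_of_nonneg _ hq]
  exact ENNReal.rpow_le_rpow (min_le_right _ _) hq

theorem truncRBound_le_rpow (hq : 0 ≤ q) (S : Set X) :
    truncRBound J q M S ≤ rBound (J '' S) ^ q :=
  ENNReal.rpow_le_rpow (min_le_left _ _) hq

theorem lowerSemicontinuous_truncRBound [TopologicalSpace X] (hJ : Continuous J) (hq : 0 ≤ q)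
    {ι : Type*} : LowerSemicontinuous fun a : ι → X => truncRBound J q M (range a) := by
  have h1 : LowerSemicontinuous fun a : ι → X => rBound (J '' range a) := by
    simpa only [← range_comp, Function.comp_def] using lowerSemicontinuous_rBound_range (ι := ι) hJ
  have hc : Continuous fun r : ℝ≥0∞ => min r M ^ q :=
    ENNReal.continuous_rpow_const.comp (by fun_prop)
  exact hc.comp_lowerSemicontinuous h1 fun r s h => ENNReal.rpow_le_rpow (min_le_min_right _ h) hq

end Truncation

/-! ### From the dyadic hypothesis to nonpositive gains -/

section Gain

variable {𝕜 H E X : Type*} [RCLike 𝕜] [NormedAddCommGroup H] [NormedSpace 𝕜 H]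
  [NormedAddCommGroup E] [NormedSpace 𝕜 E]
  [NormedAddCommGroup X] [NormedSpace 𝕜 X] [NormedSpace ℝ X] [CompleteSpace X]

/-- Boundedness of the dyadic Rademacher maximal operator, expressed through trees. -/
theorem gain_nonpos_of_dyadic {J : X →L[𝕜] H →L[𝕜] E} {p : ℝ≥0∞} (hp0 : p ≠ 0) (hp : p ≠ ∞)
    {C : ℝ≥0} (hC : ∀ f : Ico (0 : ℝ) 1 → X, MemLp f p unitIntervalMeasure →
      eLpNorm (rademacherMaximalFunction J dyadicFiltration unitIntervalMeasure f) p
        unitIntervalMeasure ≤ C * eLpNorm f p unitIntervalMeasure) (M : ℝ≥0) (t : BinTree X) :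
    BinTree.gain (fun S => (truncRBound J p.toReal M S).toReal)
      (fun x => (C ^ p.toReal : ℝ≥0) * ‖x‖ ^ p.toReal) ∅ t ≤ 0 := by
  set q := p.toReal with hqdef
  have hq : 0 < q := ENNReal.toReal_pos hp0 hp
  have h := hC _ ((BinTree.boundedMeasurable_step t).memLp p)
  rw [eLpNorm_eq_lintegral_rpow_enorm_toReal hp0 hp,
    eLpNorm_eq_lintegral_rpow_enorm_toReal hp0 hp, one_div, ENNReal.rpow_inv_le_iff hq,
    ENNReal.mul_rpow_of_nonneg _ _ hq.le, ENNReal.rpow_inv_rpow hq.ne'] at h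
  have hfin : ∀ S, truncRBound J q M S ≠ ∞ := fun S =>
    ((truncRBound_le hq.le S).trans_lt ENNReal.coe_lt_top).ne
  set R : ℝ → Set X := fun ξ => range fun j => BinTree.proj j t ξ with hR
  have h1 : ∫⁻ x in Ico (0 : ℝ) 1, truncRBound J q M (R x) ≤
      (C : ℝ≥0∞) ^ q * ∫⁻ x in Ico (0 : ℝ) 1, ‖t.step x‖ₑ ^ q := by
    rw [← lintegral_unitIntervalMeasure, ← lintegral_unitIntervalMeasure fun x => ‖t.step x‖ₑ ^ q]
    refine le_trans (lintegral_mono_ae ?_) h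
    filter_upwards [sigmaCondExp_step_ae_eq t] with ξ hξ
    refine (truncRBound_le_rpow hq.le _).trans_eq ?_
    simp only [rademacherMaximalFunction, hξ, enorm_eq_self, hR, ← range_comp, Function.comp_def, hqdef]
  -- Taking ψ = 0 isolates the measurability and boundedness of the φ term.
  have hφ := (BinTree.integral_gain (fun S => (truncRBound J q M S).toReal) 0 ∅ t).1
  simp only [Pi.zero_apply, sub_zero, union_empty] at hφ
  have hg := (BinTree.integral_gain (fun S => (truncRBound J q M S).toReal)
    (fun x => (C ^ q : ℝ≥0) * ‖x‖ ^ q) ∅ t)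
  have hsub : BoundedMeasurable fun ξ => ((C ^ q : ℝ≥0) : ℝ) * ‖t.step ξ‖ ^ q := by
    obtain ⟨hm, N, hN⟩ := BinTree.boundedMeasurable_step t
    have hc : Continuous fun x : X => ((C ^ q : ℝ≥0) : ℝ) * ‖x‖ ^ q := by
      fun_prop (disch := positivity)
    refine ⟨hc.comp_stronglyMeasurable hm, (C ^ q : ℝ≥0) * N ^ q, fun ξ => ?_⟩
    rw [Real.norm_of_nonneg (by positivity)]
    exact mul_le_mul_of_nonneg_left (Real.rpow_le_rpow (norm_nonneg _) (hN ξ) hq.le)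
      (NNReal.coe_nonneg _)
  rw [← hg.2]
  simp only [union_empty]
  rw [intervalIntegral.integral_sub (hφ.intervalIntegrable 0 1) (hsub.intervalIntegrable 0 1),
    sub_nonpos, intervalIntegral.integral_of_le zero_le_one,
    intervalIntegral.integral_of_le zero_le_one, integral_Ioc_eq_integral_Ioo,
    integral_Ioc_eq_integral_Ioo, ← integral_Ico_eq_integral_Ioo, ← integral_Ico_eq_integral_Ioo]
  have hon : ∀ {F : ℝ → ℝ}, BoundedMeasurable F → IntegrableOn F (Ico 0 1) := fun hF => by
    simpa [intervalIntegrable_iff_integrableOn_Ico_of_le] using hF.intervalIntegrable 0 1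
  rw [← ENNReal.ofReal_le_ofReal_iff (integral_nonneg fun ξ => by positivity),
    ofReal_integral_eq_lintegral_ofReal (hon hφ) (ae_of_all _ fun ξ => ENNReal.toReal_nonneg),
    ofReal_integral_eq_lintegral_ofReal (hon hsub) (ae_of_all _ fun ξ => by positivity)]
  simp only [ENNReal.ofReal_toReal (hfin _), ENNReal.ofReal_mul (NNReal.coe_nonneg _),
    ENNReal.ofReal_coe_nnreal, ← ENNReal.ofReal_rpow_of_nonneg (norm_nonneg _) hq.le, ofReal_norm]
  rw [lintegral_const_mul' _ _ ENNReal.coe_ne_top, ENNReal.coe_rpow_of_nonneg _ hq.le]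
  exact h1

end Gain

/-! ### Passage to σ-finite measure spaces -/

section SigmaFinite

variable {Ω X : Type*} {m mΩ : MeasurableSpace Ω} {μ : Measure Ω} [NormedAddCommGroup X]
  [NormedSpace ℝ X] [CompleteSpace X]

/-- On a set of finite measure in the sub-σ-algebra, the conditional expectation is the usual one
of the restricted measure. -/
theorem IsCondExp.ae_eq_condExp_restrict (hm : m ≤ mΩ) {f g : Ω → X} (hg : IsCondExp m μ f g)
    {A : Set Ω} (hA : MeasurableSet[m] A) (hμA : μ A ≠ ∞) (hf : IntegrableOn f A μ) :
    g =ᵐ[μ.restrict A] (μ.restrict A)[f | m] := by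
  have : IsFiniteMeasure (μ.restrict A) := isFiniteMeasure_restrict.2 hμA
  have hgA := hg.integrableOn A hA hμA.lt_top
  refine ae_eq_condExp_of_forall_setIntegral_eq hm hf (fun s _ _ => hgA.integrableOn)
    (fun s hs _ => ?_) hg.stronglyMeasurable.aestronglyMeasurable
  rw [Measure.restrict_restrict (hm _ hs)]
  exact hg.setIntegral_eq _ (hs.inter hA) ((measure_mono inter_subset_right).trans_lt hμA.lt_top)

variable {φ : Set X → ℝ≥0∞} {B : ℝ≥0} {c : ℝ≥0}

/-- The inequality for dyadic martingales carries over to finite martingales on σ-finite measure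
spaces. -/
theorem lintegral_isCondExp_le (hφm : Monotone φ) (hφ : ∀ S, φ S ≤ B)
    (hlsc : ∀ n, LowerSemicontinuous fun a : Fin n → X => φ (range a)) {p : ℝ≥0∞} (hp : 1 ≤ p)
    (hp' : p ≠ ∞)
    (hgain : ∀ t, BinTree.gain (fun S => (φ S).toReal) (fun x => c * ‖x‖ ^ p.toReal) ∅ t ≤ 0)
    {F : ℕ → MeasurableSpace Ω} (hF : Monotone F) (hle : ∀ n, F n ≤ mΩ)
    [SigmaFinite (μ.trim (hle 0))] {f : Ω → X} (hf : MemLp f p μ) {g : ℕ → Ω → X}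
    (hg : ∀ n, IsCondExp (F n) μ f (g n)) (n : ℕ) :
    ∫⁻ ξ, φ (range fun i : Fin (n + 1) => g i ξ) ∂μ ≤ c * ∫⁻ ξ, ‖f ξ‖ₑ ^ p.toReal ∂μ := by
  -- The pieces come from the coarsest σ-algebra `F 0`, hence belong to every `F i`, and
  -- conditioning commutes with restriction to them.
  set A : ℕ → Set Ω := disjointed (spanningSets (μ.trim (hle 0))) with hA
  have hAm0 : ∀ k, MeasurableSet[F 0] (A k) :=
    fun k => MeasurableSet.disjointed (fun i => measurableSet_spanningSets _ i) k
  have hAm : ∀ k, MeasurableSet (A k) := fun k => hle 0 _ (hAm0 k)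
  have hAd : Pairwise (Function.onFun Disjoint A) := disjoint_disjointed _
  have hAU : ⋃ k, A k = univ := by rw [hA, iUnion_disjointed, iUnion_spanningSets]
  have hAμ : ∀ k, μ (A k) ≠ ∞ := by
    intro k
    rw [← trim_measurableSet_eq (hle 0) (hAm0 k)]
    exact ((measure_mono (disjointed_subset _ k)).trans_lt
      (measure_spanningSets_lt_top _ k)).ne
  rw [← setLIntegral_univ, ← setLIntegral_univ fun ξ => ‖f ξ‖ₑ ^ p.toReal, ← hAU,
    lintegral_iUnion hAm hAd, lintegral_iUnion hAm hAd, ← ENNReal.tsum_mul_left]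
  refine ENNReal.tsum_le_tsum fun k => ?_
  have : IsFiniteMeasure (μ.restrict (A k)) := isFiniteMeasure_restrict.2 (hAμ k)
  refine le_trans (lintegral_mono_ae ?_)
    (lintegral_condExp_le hφm hφ hlsc hp hp' hgain hF hle (hf.restrict (A k)) n)
  have hae : ∀ᵐ ξ ∂μ.restrict (A k), ∀ i, g i ξ = ((μ.restrict (A k))[f | F i]) ξ :=
    ae_all_iff.2 fun i => (hg i).ae_eq_condExp_restrict (hle i) (hF (Nat.zero_le i) _ (hAm0 k))
      (hAμ k) ((hf.restrict (A k)).integrable hp)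
  filter_upwards [hae] with ξ hξ
  simp only [hξ, le_refl]

end SigmaFinite

/-! ### All times and removal of the truncation -/

section Main

variable {𝕜 H E X : Type*} [RCLike 𝕜] [NormedAddCommGroup H] [NormedSpace 𝕜 H]
  [NormedAddCommGroup E] [NormedSpace 𝕜 E]

/-- One index controls both the family and the truncation level; by monotonicity in both, this
diagonal supremum loses nothing. -/
theorem iSup_truncRBound {J : X → H →L[𝕜] E} {q : ℝ} (hq : 0 < q) {S : ℕ → Set X}
    (hS : Monotone S) :
    rBound (J '' ⋃ n, S n) ^ q = ⨆ n : ℕ, truncRBound J q n (S n) := by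
  have hJS : Monotone fun n => J '' S n := fun a b h => image_mono (hS h)
  refine le_antisymm ?_ (iSup_le fun n => (truncRBound_le_rpow hq.le _).trans
    (ENNReal.rpow_le_rpow (rBound_mono (image_mono (subset_iUnion S n))) hq.le))
  rw [image_iUnion, rBound_iUnion_of_monotone hJS, ← ENNReal.le_rpow_inv_iff hq]
  refine iSup_le fun n => le_of_forall_lt fun r hr => ?_
  obtain ⟨r', hr₁, hr₂⟩ := ENNReal.lt_iff_exists_nnreal_btwn.1 hr
  refine hr₁.trans_le ?_
  rw [ENNReal.le_rpow_inv_iff hq]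
  obtain ⟨k, hk⟩ := exists_nat_ge r'
  refine le_trans (ENNReal.rpow_le_rpow (le_min ?_ ?_) hq.le)
    (le_iSup (fun n : ℕ => truncRBound J q n (S n)) (max n k))
  · exact hr₂.le.trans (rBound_mono (hJS (le_max_left n k)))
  · refine ENNReal.coe_le_coe.2 (hk.trans ?_)
    exact_mod_cast le_max_right n k

/-- If `X` has `RMF_p` with respect to the dyadic filtration of `[0, 1)`, then it has `RMF_p` with
respect to every filtration indexed by the integers. -/
theorem HasRMF.of_dyadic [NormedAddCommGroup X] [NormedSpace 𝕜 X] [NormedSpace ℝ X]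
    [CompleteSpace X] {J : X →L[𝕜] H →L[𝕜] E} {p : ℝ≥0∞} (hp₁ : 1 < p) (hp₂ : p < ∞)
    (hdyadic : HasRMF J p dyadicFiltration unitIntervalMeasure) {Ω : Type*}
    {mΩ : MeasurableSpace Ω} (μ : Measure Ω) (ℱ : Filtration ℤ mΩ) [SigmaFiniteFiltration μ ℱ] :
    HasRMF J p ℱ μ := by
  obtain ⟨C, hC⟩ := hdyadic
  refine ⟨C, fun f hf => ?_⟩
  have hp0 : p ≠ 0 := (zero_lt_one.trans hp₁).ne'
  have hp : p ≠ ⊤ := hp₂.ne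
  have hq : 0 < p.toReal := ENNReal.toReal_pos hp0 hp
  set g : ℤ → Ω → X := fun j => sigmaCondExp (ℱ j) μ f with hg
  have hgc : ∀ j, IsCondExp (ℱ j) μ f (g j) := fun j => by
    have := SigmaFiniteFiltration.SigmaFinite (μ := μ) (f := ℱ) j
    exact isCondExp_sigmaCondExp (ℱ.le j) hp₁.le hf
  -- The window of times from -n to n, shifted by n so that the finite-martingale estimate applies
  -- with `ℱ (-n)` as its coarsest σ-algebra.
  set S : ℕ → Ω → Set X := fun n ξ =>
    range fun i : Fin (2 * n + 1) => g ((i : ℤ) - n) ξ with hS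
  have hSeq : ∀ n ξ, S n ξ = (fun j => g j ξ) '' Icc (-n : ℤ) n := by
    intro n ξ
    ext x
    constructor
    · rintro ⟨i, rfl⟩
      exact ⟨_, ⟨by omega, by omega⟩, rfl⟩
    · rintro ⟨j, ⟨h1, h2⟩, rfl⟩
      refine ⟨⟨(j + n).toNat, by omega⟩, ?_⟩
      simp only
      congr 1
      omega
  have hSm : ∀ ξ, Monotone fun n => S n ξ := fun ξ a b hab => by
    simp only [hSeq]
    exact image_mono (Icc_subset_Icc (by omega) (by omega))
  have hSU : ∀ ξ, ⋃ n, S n ξ = range fun j => g j ξ := by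
    intro ξ
    ext x
    simp only [hSeq, mem_iUnion]
    constructor
    · rintro ⟨n, j, -, rfl⟩
      exact ⟨j, rfl⟩
    · rintro ⟨j, rfl⟩
      exact ⟨j.natAbs, j, ⟨by omega, by omega⟩, rfl⟩
  have hMR : ∀ ξ, rademacherMaximalFunction J ℱ μ f ξ ^ p.toReal =
      ⨆ n : ℕ, truncRBound J p.toReal n (S n ξ) := by
    intro ξ
    rw [← iSup_truncRBound hq (hSm ξ), hSU ξ, ← range_comp]
    rfl
  have hmono : Monotone fun (n : ℕ) ξ => truncRBound J p.toReal n (S n ξ) := fun a b hab ξ =>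
    ENNReal.rpow_le_rpow (min_le_min (rBound_mono (image_mono (hSm ξ hab)))
      (by exact_mod_cast hab)) hq.le
  have hmeas : ∀ n : ℕ, Measurable fun ξ => truncRBound J p.toReal n (S n ξ) := fun n =>
    measurable_comp_of_lowerSemicontinuous
      (lowerSemicontinuous_truncRBound J.continuous hq.le)
      (stronglyMeasurable_pi_fin fun i => (hgc _).stronglyMeasurable.mono (ℱ.le _))
  have hbound : ∀ n : ℕ, ∫⁻ ξ, truncRBound J p.toReal n (S n ξ) ∂μ ≤
      (C ^ p.toReal : NNReal) * ∫⁻ ξ, ‖f ξ‖ₑ ^ p.toReal ∂μ := by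
    intro n
    have := SigmaFiniteFiltration.SigmaFinite (μ := μ) (f := ℱ) (((0 : ℕ) : ℤ) - n)
    exact lintegral_isCondExp_le (F := fun i : ℕ => ℱ ((i : ℤ) - n)) (truncRBound_mono hq.le)
      (truncRBound_le hq.le) (fun _ => lowerSemicontinuous_truncRBound J.continuous hq.le)
      hp₁.le hp (gain_nonpos_of_dyadic hp0 hp hC n) (fun a b hab => ℱ.mono (by omega))
      (fun i => ℱ.le _) hf (fun i => hgc ((i : ℤ) - n)) (2 * n)
  rw [eLpNorm_eq_lintegral_rpow_enorm_toReal hp0 hp,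
    eLpNorm_eq_lintegral_rpow_enorm_toReal hp0 hp, one_div, ENNReal.rpow_inv_le_iff hq,
    ENNReal.mul_rpow_of_nonneg _ _ hq.le, ENNReal.rpow_inv_rpow hq.ne']
  simp only [enorm_eq_self, hMR]
  -- Monotone convergence: the bound for the windows is uniform in n.
  rw [lintegral_iSup hmeas hmono, ← ENNReal.coe_rpow_of_nonneg _ hq.le]
  exact iSup_le hbound

end Main

end RademacherMaximal

theorem mainTheorem2 {𝕜 H E X : Type*} [RCLike 𝕜]
    [NormedAddCommGroup H] [NormedSpace 𝕜 H] [CompleteSpace H]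
    [NormedAddCommGroup E] [NormedSpace 𝕜 E] [CompleteSpace E]
    [NormedAddCommGroup X] [NormedSpace 𝕜 X] [NormedSpace ℝ X] [CompleteSpace X]
    (J : X →L[𝕜] H →L[𝕜] E) (hJ : Function.Injective J)
    (p : ENNReal) (hp₁ : 1 < p) (hp₂ : p < ⊤)
    (hdyadic : RademacherMaximal.HasRMF J p RademacherMaximal.dyadicFiltration
      RademacherMaximal.unitIntervalMeasure)
    {Ω : Type*} {mΩ : MeasurableSpace Ω} (μ : MeasureTheory.Measure Ω)
    [MeasureTheory.SigmaFinite μ] (ℱ : MeasureTheory.Filtration ℤ mΩ)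
    [MeasureTheory.SigmaFiniteFiltration μ ℱ] :
    RademacherMaximal.HasRMF J p ℱ μ :=
  RademacherMaximal.HasRMF.of_dyadic hp₁ hp₂ hdyadic μ ℱ
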